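/- Let $T$ be a complete NIP theory in a language $L$: no $L$-formula $\varphi(x,y)$ has, in a model of $T$, sequences $(a_i)_{i\in\mathbb N}$, $(b_I)_{I\subseteq\mathbb N}$ such that $\varphi(a_i,b_I)$ holds if and only if $i\in I$. Let $\bar M\models T$ and let $M\preceq\bar M$ be an elementary substructure. Assume that $\bar M$ is $\kappa$-saturated and either has cardinality $\kappa$ (that is, it is saturated) or is strongly $\kappa$-homogeneous, for some cardinal $\kappa>2^{2^{\lambda}}$, where $\lambda=\max(\aleph_0,|M|,|L|)$. Let $X\subseteq M^n$ be $M$-definable, and let $S_X(\bar M)$ be the set of complete $n$-types over $\bar M$ that contain the formula defining $X$. For an $L_{\bar M}$-formula $\psi(x)$ write $\psi(M)=\psi(\bar M)\cap M^n$ and $[\psi]=\{q\in S_X(\bar M):\psi\in q\}$. A type is $M$-invariant if it is fixed by all automorphisms of $\bar M$ that fix $M$ pointwise. An $L_{\bar M}$-formula $\theta(x)$ is honest over $M$ if, for every $L_M$-formula $\varphi(x)$, $\theta(M)\subseteq\varphi(M)$ implies $\theta(\bar M)\subseteq\varphi(\bar M)$. The honest topology on $S_X(\bar M)$ has as a basis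 of closed sets the sets $[\theta]$ with $\theta$ honest over $M$; its closure operator is $\mathrm{cl}^{\rm h}$. For an $M$-invariant $p\in S_X(\bar M)$, Simon's retraction $F_M(p)$ is the type $q$ over $\bar M$ such that, whenever $M\preceq M'\preceq\bar M$ with $M'$ being $|M|^+$-saturated, and $(N',N)$ with $N'\preceq\bar M$ is an $|M'|^+$-saturated elementary extension of the pair $(M',M)$ in the language $L\cup\{P\}$ (the predicate $P$ naming the smaller set), the set $p|_N(x)\cup\{P(x)\}\cup q|_{M'}(x)$ is consistent with the elementary diagram of $(N',N)$. Then, for every $M$-invariant $p\in S_X(\bar M)$, there is exactly one such type $F_M(p)$; it lies in $S_X(\bar M)$ and is finitely satisfiable in $M$. An $L_{\bar M}$-formula $\psi(x)$ belongs to $F_M(p)$ if and only if there is an $L_{\bar M}$-formula $\theta(x)\in p$, honest over $M$, such that $\theta(M)=\psi(M)$. Consequently $$F_M(p)\in\bigcap\{[\theta]:\theta\in p\text{ honest over }M\}=\mathrm{cl}^{\rm h}(p).$$ -/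

import Mathlib

open FirstOrder FirstOrder.Language Cardinal

universe u v w

namespace Honest

/-! ### Saturation, homogeneity, NIP -/

/-- `A` is `κ`-saturated: every set of formulas in one variable with parameters in a set of size
`< κ` which is finitely satisfiable in `A` is realized in `A`. -/
def IsSaturated (L : FirstOrder.Language.{u, v}) (κ : Cardinal.{w}) (A : Type w)
    [L.Structure A] : Prop :=
  ∀ B : Set A, #B < κ → ∀ Γ : Set (L[[B]].Formula (Fin 1)),
    (∀ Γ₀ : Finset (L[[B]].Formula (Fin 1)), (Γ₀ : Set (L[[B]].Formula (Fin 1))) ⊆ Γ →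
      ∃ a : Fin 1 → A, ∀ φ ∈ Γ₀, φ.Realize a) →
    ∃ a : Fin 1 → A, ∀ φ ∈ Γ, φ.Realize a

/-- `A` is strongly `κ`-homogeneous: every partial elementary map of `A` whose domain has size
`< κ` extends to an automorphism of `A`. -/
def IsStronglyHomogeneous (L : FirstOrder.Language.{u, v}) (κ : Cardinal.{w}) (A : Type w)
    [L.Structure A] : Prop :=
  ∀ B : Set A, #B < κ → ∀ f : B → A,
    (∀ φ : L.Formula B, φ.Realize (fun b : B => (b : A)) ↔ φ.Realize f) →
    ∃ σ : A ≃[L] A, ∀ b : B, σ (b : A) = f b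

/-- `A` is `κ`-saturated and, moreover, either has cardinality `κ` (so that it is saturated in the
literal sense) or is strongly `κ`-homogeneous. -/
structure IsMonster (L : FirstOrder.Language.{u, v}) (κ : Cardinal.{w}) (A : Type w)
    [L.Structure A] : Prop where
  saturated : IsSaturated L κ A
  card_eq_or_homogeneous : #A = κ ∨ IsStronglyHomogeneous L κ A

/-- The theory `T` is NIP: no formula `φ(x, y)` has, in some model of `T`, sequences `(aᵢ)`,
`i ∈ ℕ`, and `(b_I)`, `I ⊆ ℕ`, such that `φ(aᵢ, b_I)` holds if and only if `i ∈ I`. -/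
def IsNIP {L : FirstOrder.Language.{u, v}} (T : L.Theory) : Prop :=
  ∀ (k l : ℕ) (φ : L.Formula (Fin k ⊕ Fin l)) (A : Theory.ModelType.{u, v, w} T),
    ¬ ∃ (a : ℕ → Fin k → A) (b : Set ℕ → Fin l → A),
      ∀ (i : ℕ) (I : Set ℕ), φ.Realize (Sum.elim (a i) (b I)) ↔ i ∈ I

/-! ### Formulas with parameters and types over a structure -/

section Types

variable {L : FirstOrder.Language.{u, v}} {Mbar : Type w} [L.Structure Mbar] {n : ℕ}

/-- A formula with parameters in `A ⊆ Mbar`, seen as a formula with parameters in `Mbar`. -/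
def withParams (A : Set Mbar) (φ : L[[A]].Formula (Fin n)) : L[[Mbar]].Formula (Fin n) :=
  (L.lhomWithConstantsMap (fun a : A => (a : Mbar))).onFormula φ

/-- A formula with parameters in the elementary substructure `M`, seen as a formula with
parameters in `Mbar`. -/
def ofModel (M : L.ElementarySubstructure Mbar) (φ : L[[M]].Formula (Fin n)) :
    L[[Mbar]].Formula (Fin n) :=
  withParams (M : Set Mbar) φ

variable (L Mbar n) in
/-- `S_n(Mbar)`: the complete `n`-types over `Mbar`. -/
abbrev TypeSpace [Nonempty Mbar] : Type (max u v w) :=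
  (L.elementaryDiagram Mbar).CompleteType (Fin n)

variable [Nonempty Mbar]

/-- The formula `φ(x)` with parameters in `Mbar` belongs to the type `p(x)`. -/
def InType (φ : L[[Mbar]].Formula (Fin n)) (p : TypeSpace L Mbar n) : Prop :=
  Formula.equivSentence φ ∈ p

/-- The restriction `p|_A`: the formulas of `p` with parameters in `A`. -/
def restrictTo (p : TypeSpace L Mbar n) (A : Set Mbar) : Set (L[[Mbar]].Formula (Fin n)) :=
  {φ | InType φ p ∧ ∃ φ₀ : L[[A]].Formula (Fin n), withParams A φ₀ = φ}

/-- `p` is `M`-invariant: `σ(p) = p` for each automorphism `σ` of `Mbar` fixing `M` pointwise,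
where `σ(p) = {ψ(x, σ(b)) : ψ(x, b) ∈ p}`. -/
def IsInvariant (M : L.ElementarySubstructure Mbar) (p : TypeSpace L Mbar n) : Prop :=
  ∀ σ : Mbar ≃[L] Mbar, (∀ m ∈ M, σ m = m) →
    (fun ψ : L[[Mbar]].Formula (Fin n) => (L.lhomWithConstantsMap σ).onFormula ψ) ''
      {ψ | InType ψ p} = {ψ | InType ψ p}

/-- The trace `ψ(M) = ψ(Mbar) ∩ Mⁿ`. -/
def trace (M : L.ElementarySubstructure Mbar) (ψ : L[[Mbar]].Formula (Fin n)) :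
    Set (Fin n → Mbar) :=
  {a | (∀ i, a i ∈ M) ∧ ψ.Realize a}

/-- `p` is finitely satisfiable in `M`. -/
def IsFinSat (M : L.ElementarySubstructure Mbar) (p : TypeSpace L Mbar n) : Prop :=
  ∀ ψ : L[[Mbar]].Formula (Fin n), InType ψ p → (trace M ψ).Nonempty

/-- `θ` is honest over `M`. -/
def IsHonest (M : L.ElementarySubstructure Mbar) (θ : L[[Mbar]].Formula (Fin n)) : Prop :=
  ∀ φ : L[[M]].Formula (Fin n), trace M θ ⊆ trace M (ofModel M φ) →
    ∀ a : Fin n → Mbar, θ.Realize a → (ofModel M φ).Realize a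

/-- `S_X(Mbar)`, where `X` is the set defined by the formula `χ` with parameters in `M`. -/
def TypesOn (M : L.ElementarySubstructure Mbar) (χ : L[[M]].Formula (Fin n)) :
    Type (max u v w) :=
  {p : TypeSpace L Mbar n // InType (ofModel M χ) p}

/-- The set `[θ]` of the types in `S_X(Mbar)` containing `θ`. -/
def typesContaining (M : L.ElementarySubstructure Mbar) (χ : L[[M]].Formula (Fin n))
    (θ : L[[Mbar]].Formula (Fin n)) : Set (TypesOn M χ) :=
  {p | InType θ p.1}

/-- The honest topology over `M` on `S_X(Mbar)`, in which the sets `[θ]` with `θ` honest over `M`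
are the basic closed sets. -/
instance honestTopology (M : L.ElementarySubstructure Mbar) (χ : L[[M]].Formula (Fin n)) :
    TopologicalSpace (TypesOn M χ) :=
  TopologicalSpace.generateFrom
    {U | ∃ θ : L[[Mbar]].Formula (Fin n), IsHonest M θ ∧ U = (typesContaining M χ θ)ᶜ}

end Types

/-! ### Pairs of models and Simon's retraction -/

/-- The relation symbols of the language with one unary predicate. -/
inductive PredSymbol : ℕ → Type
  | P : PredSymbol 1

/-- The language with one unary predicate `P`. -/
def predLanguage : FirstOrder.Language.{0, 0} := ⟨fun _ => Empty, PredSymbol⟩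

/-- The language `L_P = L ∪ {P}`. -/
abbrev pairLanguage (L : FirstOrder.Language.{u, v}) : FirstOrder.Language.{u, v} :=
  L.sum predLanguage

/-- The underlying set of the pair `(A, S)`, where `S` is the interpretation of `P`. -/
def PairOf (A : Type w) (_S : Set A) : Type w := A

/-- An element of the pair `(A, S)`, seen as an element of `A`. -/
def PairOf.toBase {A : Type w} {S : Set A} (x : PairOf A S) : A := x

/-- An element of `A`, seen as an element of the pair `(A, S)`. -/
def PairOf.ofBase {A : Type w} (S : Set A) (x : A) : PairOf A S := x

instance pairBase (L : FirstOrder.Language.{u, v}) (A : Type w) [h : L.Structure A] (S : Set A) :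
    L.Structure (PairOf A S) := h

instance pairPred (A : Type w) (S : Set A) : predLanguage.Structure (PairOf A S) where
  funMap := fun f _ => nomatch f
  RelMap := fun r x => match r, x with
    | PredSymbol.P, x => x 0 ∈ S

section Retraction

variable {L : FirstOrder.Language.{u, v}} {Mbar : Type w} [L.Structure Mbar] {n : ℕ}

/-- The pair `(A, S)` for an elementary substructure `A` of `Mbar` and a set `S`. -/
abbrev pairIn (A : L.ElementarySubstructure Mbar) (S : Set Mbar) : Type w :=
  PairOf A {x : A | (x : Mbar) ∈ S}

/-- The auxiliary models in the construction of `F_M`: models `M'` and `N'` inside `Mbar` such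
that `M'` is an `|M|⁺`-saturated elementary extension of `M` and `(N', N)` is an
`|M'|⁺`-saturated elementary extension of the `L_P`-structure `(M', M)`. -/
structure SimonPair (M : L.ElementarySubstructure Mbar) where
  /-- the model `M'` -/
  M' : L.ElementarySubstructure Mbar
  /-- the model `N'` -/
  N' : L.ElementarySubstructure Mbar
  /-- the interpretation `N` of `P` in `N'` -/
  N : Set Mbar
  M_le : (M : Set Mbar) ⊆ M'
  saturated_M' : IsSaturated L (Order.succ #M) M'
  N_sub : N ⊆ N'
  elementary : ∃ f : pairIn M' (M : Set Mbar) ↪ₑ[pairLanguage L] pairIn N' N,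
    ∀ x : M', ((f (PairOf.ofBase _ x)).toBase : Mbar) = x
  saturated_pair : IsSaturated (pairLanguage L) (Order.succ #M') (pairIn N' N)

/-- For a set `Γ(x)` of formulas with parameters in `N'`, consistency of `Γ(x) ∪ {P(x)}` with the
elementary diagram of the pair `(N', N)`, that is, finite satisfiability of `Γ(x) ∪ {P(x)}` in
`(N', N)`. Here truth in `N'` is the same as truth in `Mbar`, as `N' ≼ Mbar`. -/
def ConsistentWithP (N : Set Mbar) (Γ : Set (L[[Mbar]].Formula (Fin n))) : Prop :=
  ∀ Γ₀ : Finset (L[[Mbar]].Formula (Fin n)), (Γ₀ : Set (L[[Mbar]].Formula (Fin n))) ⊆ Γ →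
    ∃ a : Fin n → Mbar, (∀ i, a i ∈ N) ∧ ∀ φ ∈ Γ₀, φ.Realize a

variable [Nonempty Mbar]

/-- The type `q` over `Mbar` is the value `F_M(p)` of Simon's retraction at `p`: for all auxiliary
models `M'`, `(N', N)` the set `p|_N ∪ {P(x)} ∪ q|_{M'}` is consistent. -/
def IsSimonRetract (M : L.ElementarySubstructure Mbar) (p q : TypeSpace L Mbar n) : Prop :=
  ∀ D : SimonPair M,
    ConsistentWithP D.N (restrictTo p D.N ∪ restrictTo q (D.M' : Set Mbar))

end Retraction

end Honest

/-!
A type over `Mbar` is handled through an ultrafilter `U` on tuples, of which only the definable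
members matter. For a pair `(N', N)` over `(M', M)`, let `F` be the filter generated by the sets of
`U` definable over `N` together with `Nⁿ`.

If `U` is `M`-invariant, `F` decides every set `Y` definable over `M'`. Otherwise saturation of the
pair produces points of `Nⁿ` inside and outside `Y` realizing `U` over `M` and any given few
elements of `N`. Hence every subset of `ℕ` is the set of indices at which some Morley sequence of
`U` over `M` lies in `Y`. By invariance all these sequences have the same type over `M`, so a single
one already has every pattern realized by some parameter, contradicting NIP.

Ultrafilters concentrated on `Mⁿ` are invariant. Applying the dichotomy to them, compactness gives
for each `Y` an honest `Θ` with `Y ∩ Mⁿ ⊆ Θ` and `Θ ∩ Nⁿ ⊆ Y`. It follows that `Y` belongs to `F`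
exactly when some honest member of `U` has the same trace on `M` as `Y`. This criterion no longer
mentions the pair, so the sets satisfying it form a complete type, which is the retract of `U`;
being concentrated on traces, it is finitely satisfiable in `M`.

Enough such pairs exist because a structure of size at most `2 ^ l` has an `l⁺`-saturated elementary
extension of size at most `2 ^ l`, found as an elementary submodel of an ultrapower by a good enough
ultrafilter; such an extension embeds into `Mbar` by saturation.
-/

namespace Honest

section SameType

variable {L : FirstOrder.Language.{u, v}} {α β X Y : Type*} [L.Structure X] [L.Structure Y]

variable (L) in
/-- The tuples `f` and `g`, possibly in different structures, satisfy the same formulas. -/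
def SameType (f : α → X) (g : α → Y) : Prop :=
  ∀ φ : L.Formula α, φ.Realize f ↔ φ.Realize g

theorem SameType.symm {f : α → X} {g : α → Y} (h : SameType L f g) : SameType L g f :=
  fun φ => (h φ).symm

theorem SameType.comp {f : α → X} {g : α → Y} (h : SameType L f g) (s : β → α) :
    SameType L (f ∘ s) (g ∘ s) :=
  fun φ => by simpa only [Formula.realize_relabel] using h (φ.relabel s)

theorem SameType.eq_iff {f : α → X} {g : α → Y} (h : SameType L f g) (i j : α) :
    f i = f j ↔ g i = g j := by
  simpa only [Formula.realize_equal, Term.realize_var] using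
    h ((Term.var i).equal (Term.var j))

theorem SameType.of_finset {f : α → X} {g : α → Y}
    (h : ∀ t : Finset α, SameType L (fun i : t => f i) (fun i : t => g i)) :
    SameType L f g := by
  classical
  intro φ
  have := h φ.freeVarFinset (φ.restrictFreeVar id)
  rw [Formula.Realize, BoundedFormula.realize_restrictFreeVar f (by simp)] at this
  rw [Formula.Realize, BoundedFormula.realize_restrictFreeVar g (by simp)] at this
  exact this

theorem SameType.of_realize_imp {f : α → X} {g : α → Y}
    (h : ∀ φ : L.Formula α, φ.Realize f → φ.Realize g) : SameType L f g :=
  fun φ => ⟨h φ, not_imp_not.1 (h φ.not)⟩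

/-- The elementary embedding with underlying function `g`. -/
def SameType.elementaryEmbedding {g : X → Y} (h : SameType L id g) : X ↪ₑ[L] Y where
  toFun := g
  map_formula' _ φ x := (h.comp x φ).symm

/-- The isomorphism given by a surjective elementary embedding. -/
noncomputable def equivOfSurjective (g : X ↪ₑ[L] Y) (hg : Function.Surjective g) : X ≃[L] Y where
  toEquiv := Equiv.ofBijective g ⟨g.injective, hg⟩
  map_fun' := g.map_fun
  map_rel' := g.map_rel

theorem sameType_embedding (g : X ↪ₑ[L] Y) (f : α → X) : SameType L (g ∘ f) f :=
  fun φ => g.map_formula φ f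

theorem definable_setOf_realize {B : Set X} {b : β → X} (hb : ∀ i, b i ∈ B)
    (φ : L.Formula (β ⊕ α)) : B.Definable L {a : α → X | φ.Realize (Sum.elim b a)} := by
  refine Set.definable_iff_exists_formula_sum.2
    ⟨φ.relabel (Sum.map (fun i => ⟨b i, hb i⟩) id), ?_⟩
  simp only [Formula.realize_relabel, Sum.elim_comp_map]
  rfl

theorem definable_setOf_comp_mem (g : X ↪ₑ[L] Y) {B : Set X} {Z : Set (α → Y)}
    (hZ : (g '' B).Definable L Z) : B.Definable L {x | g ∘ x ∈ Z} := by
  obtain ⟨φ, rfl⟩ := Set.definable_iff_exists_formula_sum.1 hZ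
  choose b hb hgb using fun c : g '' B => c.2
  convert definable_setOf_realize hb φ using 1
  ext x
  refine Iff.trans (iff_of_eq (congrArg φ.Realize ?_)) (sameType_embedding g (Sum.elim b x) φ)
  rw [Sum.comp_elim]
  exact congrArg₂ Sum.elim (funext fun c => (hgb c).symm) rfl

theorem exists_definable_comp_mem_iff (g : X ↪ₑ[L] Y) {B : Set X} {Z : Set (α → X)}
    (hZ : B.Definable L Z) : ∃ Z' : Set (α → Y), (g '' B).Definable L Z' ∧
      ∀ x, g ∘ x ∈ Z' ↔ x ∈ Z := by
  obtain ⟨φ, rfl⟩ := Set.definable_iff_exists_formula_sum.1 hZ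
  refine ⟨_, definable_setOf_realize (b := fun b : B => g b)
    (fun b => Set.mem_image_of_mem g b.2) φ, fun x => ?_⟩
  rw [Set.mem_ofPred_eq, Set.mem_ofPred_eq, ← sameType_embedding g, Sum.comp_elim]
  rfl

/-- The image of an elementary embedding, an elementary substructure. -/
def elementaryRange (g : X ↪ₑ[L] Y) : L.ElementarySubstructure Y where
  toSubstructure := g.toEmbedding.toHom.range
  isElementary' n φ x := by
    obtain ⟨y, rfl⟩ : ∃ y, g.toEmbedding.equivRange ∘ y = x :=
      ⟨g.toEmbedding.equivRange.symm ∘ x,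
        funext fun i => g.toEmbedding.equivRange.apply_symm_apply (x i)⟩
    exact (g.map_formula φ y).trans (StrongHomClass.realize_formula _ φ).symm

theorem coe_elementaryRange (g : X ↪ₑ[L] Y) : (elementaryRange g : Set Y) = Set.range g :=
  Hom.range_coe _

/-- An elementary embedding, as an isomorphism onto its image. -/
noncomputable def equivElementaryRange (g : X ↪ₑ[L] Y) : X ≃[L] elementaryRange g :=
  g.toEmbedding.equivRange

end SameType

section ElementaryRelations

variable {L : FirstOrder.Language.{u, v}} {α X Y : Type*} [L.Structure X] [L.Structure Y]

variable (L) in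
/-- A relation between two structures is elementary if it relates tuples satisfying the same
formulas; when it is the graph of a partial map, that map is a partial elementary map. -/
def IsElementaryRel (R : Set (X × Y)) : Prop :=
  SameType L (fun r : R => r.1.1) (fun r : R => r.1.2)

theorem IsElementaryRel.sameType {R : Set (X × Y)} (h : IsElementaryRel L R) {f : α → X}
    {g : α → Y} (hfg : ∀ i, (f i, g i) ∈ R) : SameType L f g :=
  h.comp fun i => ⟨(f i, g i), hfg i⟩

theorem SameType.isElementaryRel {f : α → X} {g : α → Y} (h : SameType L f g)
    {R : Set (X × Y)} (hR : ∀ r ∈ R, ∃ i, (f i, g i) = r) : IsElementaryRel L R := by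
  choose i hi using fun r : R => hR r r.2
  have hfst : (fun r : R => r.1.1) = f ∘ i := funext fun r => congrArg Prod.fst (hi r).symm
  have hsnd : (fun r : R => r.1.2) = g ∘ i := funext fun r => congrArg Prod.snd (hi r).symm
  rw [IsElementaryRel, hfst, hsnd]
  exact h.comp i

theorem IsElementaryRel.mono {R R' : Set (X × Y)} (h : IsElementaryRel L R') (hR : R ⊆ R') :
    IsElementaryRel L R :=
  h.sameType fun r => hR r.2

theorem IsElementaryRel.image_swap {R : Set (X × Y)} (h : IsElementaryRel L R) :
    IsElementaryRel L (Prod.swap '' R) :=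
  h.symm.isElementaryRel fun _ ⟨r, hr, hs⟩ => ⟨⟨r, hr⟩, hs⟩

theorem IsElementaryRel.snd_eq {R : Set (X × Y)} (h : IsElementaryRel L R) {r r' : X × Y}
    (hr : r ∈ R) (hr' : r' ∈ R) (hfst : r.1 = r'.1) : r.2 = r'.2 :=
  (h.eq_iff ⟨r, hr⟩ ⟨r', hr'⟩).1 hfst

variable (L X Y) in
theorem isOfFiniteCharacter_isElementaryRel :
    Order.IsOfFiniteCharacter {R : Set (X × Y) | IsElementaryRel L R} := by
  classical
  refine fun R => ⟨fun h t ht _ => h.mono ht, fun h => SameType.of_finset fun t => ?_⟩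
  have hsub : ((t.image Subtype.val : Finset (X × Y)) : Set (X × Y)) ⊆ R := by
    intro r hr
    obtain ⟨s, -, rfl⟩ := Finset.mem_image.1 (Finset.mem_coe.1 hr)
    exact s.2
  exact (h _ hsub (Finset.finite_toSet _)).sameType fun i => Finset.mem_image_of_mem _ i.2

theorem IsElementaryRel.exists_elementaryEmbedding {R : Set (X × Y)} (h : IsElementaryRel L R)
    (hdom : ∀ x, ∃ y, (x, y) ∈ R) : ∃ g : X ↪ₑ[L] Y, ∀ r ∈ R, g r.1 = r.2 := by
  choose g hg using hdom
  exact ⟨(h.sameType hg).elementaryEmbedding, fun r hr => h.snd_eq (hg r.1) hr rfl⟩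

theorem IsElementaryRel.exists_equiv {R : Set (X × Y)} (h : IsElementaryRel L R)
    (hdom : ∀ x, ∃ y, (x, y) ∈ R) (hran : ∀ y, ∃ x, (x, y) ∈ R) :
    ∃ σ : X ≃[L] Y, ∀ r ∈ R, σ r.1 = r.2 := by
  obtain ⟨g, hg⟩ := h.exists_elementaryEmbedding hdom
  exact ⟨equivOfSurjective g fun y => (hran y).imp fun x hx => hg _ hx, hg⟩

end ElementaryRelations

section Saturation

variable {L : FirstOrder.Language.{u, v}} {X Y : Type w} [L.Structure X] [L.Structure Y]
  {κ : Cardinal.{w}}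

theorem isSaturated_iff_forall_filter :
    IsSaturated L κ Y ↔ ∀ B : Set Y, #B < κ → ∀ F : Filter (Fin 1 → Y), F.NeBot →
      ∃ a, ∀ Z ∈ F, B.Definable L Z → a ∈ Z := by
  refine forall₂_congr fun B _ => ⟨fun h F _ => ?_, fun h Γ hΓ => ?_⟩
  · obtain ⟨a, ha⟩ := h {φ | ∀ᶠ y in F, φ.Realize y} fun Γ₀ hΓ₀ =>
      ((Filter.eventually_all_finset Γ₀).2 fun φ hφ => hΓ₀ hφ).exists
    refine ⟨a, ?_⟩
    rintro _ hZ ⟨φ, rfl⟩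
    exact ha φ hZ
  · let solutions : L[[B]].Formula (Fin 1) → Set (Fin 1 → Y) := fun φ => {y | φ.Realize y}
    have hne : (Filter.generate (solutions '' Γ)).NeBot := by
      classical
      refine Filter.generate_neBot_iff.2 fun t ht hfin => ?_
      obtain ⟨Γ₀, hΓ₀, hfin₀, rfl⟩ := Set.exists_subset_image_finite_and.1 ⟨t, ht, hfin, rfl⟩
      obtain ⟨a, ha⟩ := hΓ hfin₀.toFinset (by simpa using hΓ₀)
      exact ⟨a, Set.forall_mem_image.2 fun φ hφ => ha φ (hfin₀.mem_toFinset.2 hφ)⟩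
    obtain ⟨a, ha⟩ := h _ hne
    exact ⟨a, fun φ hφ => ha _ (Filter.mem_generate_of_mem ⟨φ, hφ, rfl⟩) ⟨φ, rfl⟩⟩

theorem IsSaturated.mono {κ' : Cardinal.{w}} (h : IsSaturated L κ Y) (hle : κ' ≤ κ) :
    IsSaturated L κ' Y :=
  fun B hB => h B (hB.trans_le hle)

theorem IsSaturated.of_equiv (hX : IsSaturated L κ X) (e : X ≃[L] Y) : IsSaturated L κ Y := by
  refine isSaturated_iff_forall_filter.2 fun B hB F hF => ?_
  obtain ⟨a, ha⟩ := isSaturated_iff_forall_filter.1 hX (e ⁻¹' B)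
    ((Cardinal.mk_preimage_equiv e.toEquiv B).trans_lt hB) (F.map (e.symm ∘ ·)) inferInstance
  refine ⟨e ∘ a, fun Z hZ hdef => ?_⟩
  have hdef' := definable_setOf_comp_mem e.toElementaryEmbedding (B := e ⁻¹' B)
    (show (e '' (e ⁻¹' B)).Definable L Z by rwa [Set.image_preimage_eq _ e.surjective])
  refine ha _ (Filter.mem_map.2 ?_) hdef'
  filter_upwards [hZ] with y hy
  change e ∘ e.symm ∘ y ∈ Z
  simpa only [Function.comp_def, Language.Equiv.apply_symm_apply] using hy

variable (L) in
/-- The type of `x` over the first coordinates of `R`, carried along `R`: the filter generated by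
the solution sets, over the second coordinates of `R`, of the formulas satisfied by `x`. -/
def transportedType (R : Set (X × Y)) (x : X) : Filter (Fin 1 → Y) where
  sets := {Z | ∃ φ : L.Formula (R ⊕ Fin 1), φ.Realize (Sum.elim (fun r => r.1.1) fun _ => x) ∧
    {y | φ.Realize (Sum.elim (fun r => r.1.2) y)} ⊆ Z}
  univ_sets := ⟨⊤, Formula.realize_top.2 trivial, Set.subset_univ _⟩
  sets_of_superset := fun ⟨φ, hφ, hZ⟩ hZZ' => ⟨φ, hφ, hZ.trans hZZ'⟩
  inter_sets := fun ⟨φ, hφ, hZ⟩ ⟨ψ, hψ, hZ'⟩ =>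
    ⟨φ ⊓ ψ, Formula.realize_inf.2 ⟨hφ, hψ⟩, fun _ hy =>
      ⟨hZ (Formula.realize_inf.1 hy).1, hZ' (Formula.realize_inf.1 hy).2⟩⟩

theorem IsElementaryRel.neBot_transportedType {R : Set (X × Y)} (h : IsElementaryRel L R) (x : X) :
    (transportedType L R x).NeBot := by
  refine Filter.neBot_iff.2 fun hbot => ?_
  obtain ⟨φ, hφ, hempty⟩ := Filter.empty_mem_iff_bot.2 hbot
  obtain ⟨y, hy⟩ := Formula.realize_iExs.1
    ((h (φ.iExs (Fin 1))).1 (Formula.realize_iExs.2 ⟨fun _ => x, hφ⟩))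
  exact hempty hy

theorem IsElementaryRel.exists_insert {R : Set (X × Y)} (h : IsElementaryRel L R)
    (hY : IsSaturated L κ Y) (hR : #R < κ) (x : X) :
    ∃ y, IsElementaryRel L (insert (x, y) R) := by
  obtain ⟨y, hy⟩ := isSaturated_iff_forall_filter.1 hY (Prod.snd '' R)
    (Cardinal.mk_image_le.trans_lt hR) _ (h.neBot_transportedType x)
  have hsame : SameType L (Sum.elim (fun r : R => r.1.1) fun _ : Fin 1 => x)
      (Sum.elim (fun r : R => r.1.2) y) :=
    .of_realize_imp fun φ hφ => hy _ ⟨φ, hφ, subset_rfl⟩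
      (definable_setOf_realize (fun r : R => Set.mem_image_of_mem Prod.snd r.2) φ)
  refine ⟨y 0, hsame.isElementaryRel ?_⟩
  rintro r (rfl | hr)
  · exact ⟨Sum.inr 0, rfl⟩
  · exact ⟨Sum.inl ⟨r, hr⟩, rfl⟩

theorem IsElementaryRel.exists_insert_fst {R : Set (X × Y)} (h : IsElementaryRel L R)
    (hX : IsSaturated L κ X) (hR : #R < κ) (y : Y) :
    ∃ x, IsElementaryRel L (insert (x, y) R) := by
  obtain ⟨x, hx⟩ := h.image_swap.exists_insert hX (Cardinal.mk_image_le.trans_lt hR) y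
  refine ⟨x, ?_⟩
  simpa only [Set.image_insert_eq, Set.image_swap_eq_preimage_swap, Set.preimage_preimage,
    Prod.swap_swap, Set.preimage_id', Prod.swap_prod_mk] using hx.image_swap

theorem IsElementaryRel.mk_fiber_le {R : Set (X × Y)} (h : IsElementaryRel L R) (S : Set X) :
    #{r ∈ R | r.1 ∈ S} ≤ #S :=
  Cardinal.mk_le_of_injective (f := fun r : {r ∈ R | r.1 ∈ S} => (⟨r.1.1, r.2.2⟩ : S))
    fun r r' hrr => by
      have hfst := congrArg Subtype.val hrr
      exact Subtype.ext (Prod.ext hfst (h.snd_eq r.2.1 r'.2.1 hfst))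

theorem IsElementaryRel.exists_extend {R : Set (X × Y)} (h : IsElementaryRel L R)
    (hY : IsSaturated L κ Y) (hκ : ℵ₀ ≤ κ) (hR : #R < κ) {S : Set X} (hS : #S < κ) :
    ∃ R', R ⊆ R' ∧ IsElementaryRel L R' ∧ ∀ s ∈ S, ∃ y, (s, y) ∈ R' := by
  obtain ⟨R', hsub, hmax⟩ := zorn_subset_nonempty
    {R' : Set (X × Y) | IsElementaryRel L R' ∧ ∀ r ∈ R', r ∈ R ∨ r.1 ∈ S} (by
      intro C hC hchain hne
      refine ⟨⋃₀ C, ⟨?_, fun r ⟨R₁, hR₁, hr⟩ => (hC hR₁).2 r hr⟩,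
        fun _ => Set.subset_sUnion_of_mem⟩
      refine (isOfFiniteCharacter_isElementaryRel L X Y _).2 fun t ht hfin => ?_
      lift t to Finset (X × Y) using hfin
      rw [Set.sUnion_eq_biUnion] at ht
      obtain ⟨R₁, hR₁, htR₁⟩ := DirectedOn.exists_mem_subset_of_finset_subset_biUnion hne
        (f := id) hchain.directedOn ht
      exact (hC hR₁).1.mono htR₁) R ⟨h, fun _ => Or.inl⟩
  obtain ⟨helem, hdom⟩ := hmax.prop
  have hcard : #R' < κ := by
    have hcover : R' ⊆ R ∪ {r ∈ R' | r.1 ∈ S} := fun r hr =>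
      (hdom r hr).imp_right fun hrS => ⟨hr, hrS⟩
    exact (Cardinal.mk_le_mk_of_subset hcover).trans_lt ((Cardinal.mk_union_le _ _).trans_lt
      (Cardinal.add_lt_of_lt hκ hR ((helem.mk_fiber_le S).trans_lt hS)))
  refine ⟨R', hsub, helem, fun s hs => ?_⟩
  obtain ⟨y, hy⟩ := helem.exists_insert hY hcard s
  refine ⟨y, hmax.le_of_ge ⟨hy, ?_⟩ (Set.subset_insert _ _) (Set.mem_insert _ _)⟩
  rintro r (rfl | hr)
  · exact Or.inr hs
  · exact hdom r hr

theorem IsSaturated.exists_comp_eq {A : Type w} [L.Structure A] (hY : IsSaturated L κ Y)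
    (hκ : ℵ₀ ≤ κ) (hX : #X < κ) (f : A ↪ₑ[L] X) (i : A ↪ₑ[L] Y) :
    ∃ g : X ↪ₑ[L] Y, ∀ a, g (f a) = i a := by
  have hsame : SameType L f i := fun φ => (sameType_embedding f id φ).trans
    (sameType_embedding i id φ).symm
  have hA : #A < κ := (Cardinal.mk_le_of_injective f.injective).trans_lt hX
  obtain ⟨R, hsub, hR, hdom⟩ := (hsame.isElementaryRel fun _ => id).exists_extend hY hκ
    (R := Set.range fun a => (f a, i a)) (Cardinal.mk_range_le.trans_lt hA)
    (S := Set.univ) (by rwa [Cardinal.mk_univ])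
  obtain ⟨g, hg⟩ := hR.exists_elementaryEmbedding fun x => hdom x trivial
  exact ⟨g, fun a => hg _ (hsub ⟨a, rfl⟩)⟩

end Saturation

section TransfiniteConstruction

theorem exists_transfinite_extension {ι Z : Type*} [LinearOrder ι] [WellFoundedLT ι]
    {𝒞 : Set (Set Z)} (h𝒞 : Order.IsOfFiniteCharacter 𝒞) {Q : ι → Set Z → Set Z → Prop}
    (hQ : ∀ j, ∀ R ∈ 𝒞, ∃ S, R ∪ S ∈ 𝒞 ∧ Q j R S) {R₀ : Set Z} (hR₀ : R₀ ∈ 𝒞) :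
    ∃ g : ι → Set Z, R₀ ∪ ⋃ j, g j ∈ 𝒞 ∧ ∀ j, Q j (R₀ ∪ ⋃ i ∈ Set.Iio j, g i) (g j) := by
  classical
  choose! step hstep hQstep using hQ
  let g : ι → Set Z := wellFounded_lt.fix fun j g => step j (R₀ ∪ ⋃ (i) (h : i < j), g i h)
  have hg : ∀ j, g j = step j (R₀ ∪ ⋃ i ∈ Set.Iio j, g i) := fun j => wellFounded_lt.fix_eq _ j
  have hunion : ∀ s : Set ι, (∀ j ∈ s, R₀ ∪ ⋃ i ∈ Set.Iic j, g i ∈ 𝒞) →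
      R₀ ∪ ⋃ i ∈ s, g i ∈ 𝒞 := by
    intro s hs
    rcases s.eq_empty_or_nonempty with rfl | hne
    · simpa using hR₀
    refine (h𝒞 _).2 fun t ht hfin => ?_
    lift t to Finset Z using hfin
    have hmono : Monotone fun j => R₀ ∪ ⋃ i ∈ Set.Iic j, g i := fun j k hjk =>
      Set.union_subset_union_right _ (Set.biUnion_subset_biUnion_left (Set.Iic_subset_Iic.2 hjk))
    obtain ⟨j, hj, htj⟩ := DirectedOn.exists_mem_subset_of_finset_subset_biUnion hne (s := t)
      (f := fun j => R₀ ∪ ⋃ i ∈ Set.Iic j, g i) (fun j hj k hk => (le_total j k).elim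
        (fun h => ⟨k, hk, hmono h, subset_rfl⟩) fun h => ⟨j, hj, subset_rfl, hmono h⟩)
      (ht.trans (Set.union_subset
        (Set.subset_biUnion_of_mem hne.some_mem |>.trans' Set.subset_union_left)
        (Set.iUnion₂_mono fun j _ => (Set.subset_biUnion_of_mem (Set.self_mem_Iic)).trans
          Set.subset_union_right)))
    exact (h𝒞 _).1 (hs j hj) t htj t.finite_toSet
  have hmem : ∀ j, R₀ ∪ ⋃ i ∈ Set.Iic j, g i ∈ 𝒞 := fun j => by
    induction j using WellFoundedLT.induction with
    | ind j ih =>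
      rw [← Set.Iio_insert, Set.biUnion_insert, Set.union_comm (g j), ← Set.union_assoc, hg j]
      exact hstep j _ (hunion _ ih)
  refine ⟨g, ?_, fun j => ?_⟩
  · simpa using hunion Set.univ fun j _ => hmem j
  · rw [hg j]
    exact hQstep j _ (hunion _ fun i _ => hmem i)

theorem isOfFiniteCharacter_neBot_generate (W : Type*) :
    Order.IsOfFiniteCharacter {𝒳 : Set (Set W) | (Filter.generate 𝒳).NeBot} := by
  intro 𝒳
  simp only [Set.mem_ofPred_eq, Filter.generate_neBot_iff]
  exact ⟨fun h t ht _ s hs => h s (hs.trans ht),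
    fun h t ht hfin => h t ht hfin t subset_rfl hfin⟩

theorem exists_greedy_ultrafilter {ι W : Type*} [LinearOrder ι] [WellFoundedLT ι] [Nonempty W]
    (E : ι → Set (Set W)) : ∃ U : Ultrafilter W, ∀ j,
      (Filter.generate ({Z | Z ∈ U ∧ ∃ i < j, Z ∈ E i} ∪ E j)).NeBot → ∀ Z ∈ E j, Z ∈ U := by
  classical
  obtain ⟨g, hne, hg⟩ := exists_transfinite_extension (isOfFiniteCharacter_neBot_generate W)
    (Q := fun j R S => S ⊆ E j ∧ ((Filter.generate (R ∪ E j)).NeBot → E j ⊆ S))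
    (R₀ := ∅) (fun j R hR => by
      by_cases h : (Filter.generate (R ∪ E j)).NeBot
      · exact ⟨E j, h, subset_rfl, fun _ => subset_rfl⟩
      · exact ⟨∅, by rwa [Set.union_empty], Set.empty_subset _, fun h' => absurd h' h⟩)
    (by rw [Set.mem_ofPred_eq, Filter.generate_empty]; infer_instance)
  simp only [Set.empty_union] at hne hg
  have : (Filter.generate (⋃ j, g j)).NeBot := hne
  have hU : ∀ j, ∀ Z ∈ g j, Z ∈ Ultrafilter.of (Filter.generate (⋃ j, g j)) := fun j Z hZ =>
    Ultrafilter.of_le _ (Filter.mem_generate_of_mem (Set.mem_iUnion_of_mem j hZ))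
  refine ⟨.of (Filter.generate (⋃ j, g j)), fun j hj Z hZ => hU j Z ((hg j).2 ?_ hZ)⟩
  refine hj.mono (Filter.le_generate_iff.2 fun Z hZ => Filter.mem_generate_of_mem
    (Set.union_subset_union_left _ ?_ hZ))
  refine Set.iUnion₂_subset fun i hi Y hY => ?_
  exact ⟨hU i Y hY, i, hi, (hg i).1 hY⟩

end TransfiniteConstruction

section Homogeneity

variable {L : FirstOrder.Language.{u, v}} {A : Type w} [L.Structure A] {κ : Cardinal.{w}}

theorem mk_union_biUnion_Iio_lt {Z : Type w} (hκ : ℵ₀ < κ) {R : Set Z} (hR : #R < κ)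
    {g : κ.ord.ToType → Set Z} (hg : ∀ j, #(g j) ≤ ℵ₀) (j : κ.ord.ToType) :
    #(R ∪ ⋃ i ∈ Set.Iio j, g i : Set Z) < κ := by
  refine (Cardinal.mk_union_le _ _).trans_lt (Cardinal.add_lt_of_lt hκ.le hR ?_)
  rw [Set.biUnion_eq_iUnion]
  refine Cardinal.mk_iUnion_le_sum_mk.trans_lt ((Cardinal.sum_le_sum _ (fun _ => ℵ₀)
    fun i : Set.Iio j => hg i).trans_lt ?_)
  rw [Cardinal.sum_const']
  exact Cardinal.mul_lt_of_lt hκ.le (by simpa using Cardinal.mk_Iio_lt j) hκ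

theorem IsElementaryRel.exists_pair (hA : IsSaturated L κ A) (hκ : ℵ₀ ≤ κ) {R : Set (A × A)}
    (h : IsElementaryRel L R) (hR : #R < κ) (a : A) :
    ∃ x y, IsElementaryRel L (R ∪ {(a, y), (x, a)}) := by
  obtain ⟨y, hy⟩ := h.exists_insert hA hR a
  obtain ⟨x, hx⟩ := hy.exists_insert_fst hA (Cardinal.mk_insert_le.trans_lt
    (Cardinal.add_lt_of_lt hκ hR (Cardinal.one_lt_aleph0.trans_le hκ))) a
  refine ⟨x, y, hx.mono ?_⟩
  rw [Set.union_comm, Set.insert_union, Set.singleton_union, Set.insert_comm]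

theorem IsSaturated.isStronglyHomogeneous (hA : IsSaturated L κ A) (hκ : ℵ₀ < κ)
    (hcard : #A = κ) : IsStronglyHomogeneous L κ A := by
  intro B hB f hf
  obtain ⟨e⟩ : Nonempty (κ.ord.ToType ≃ A) := by
    rw [← Cardinal.eq, Cardinal.mk_ord_toType, hcard]
  have hstep : ∀ (j : κ.ord.ToType), ∀ R ∈ {R : Set (A × A) | IsElementaryRel L R}, ∃ S,
      IsElementaryRel L (R ∪ S) ∧ #S ≤ ℵ₀ ∧
        (#R < κ → (∃ y, (e j, y) ∈ S) ∧ ∃ x, (x, e j) ∈ S) := by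
    intro j R hR
    by_cases hRκ : #R < κ
    · obtain ⟨x, y, h⟩ := IsElementaryRel.exists_pair hA hκ.le hR hRκ (e j)
      exact ⟨_, h, ((Set.toFinite _).countable).le_aleph0, fun _ => ⟨⟨y, by simp⟩, x, by simp⟩⟩
    · exact ⟨∅, by rwa [Set.union_empty], by simp, fun h => absurd h hRκ⟩
  obtain ⟨g, helem, hg⟩ := exists_transfinite_extension
    (isOfFiniteCharacter_isElementaryRel L A A) hstep
    (SameType.isElementaryRel hf fun _ => id : IsElementaryRel L (.range fun b : B => (↑b, f b)))
  have hsize := mk_union_biUnion_Iio_lt hκ (R := .range fun b : B => ((b : A), f b))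
    (Cardinal.mk_range_le.trans_lt hB) fun j => (hg j).1
  have htotal : ∀ a, (∃ y, (a, y) ∈ ⋃ j, g j) ∧ ∃ x, (x, a) ∈ ⋃ j, g j := by
    refine e.surjective.forall.2 fun j => ?_
    obtain ⟨⟨y, hy⟩, x, hx⟩ := (hg j).2 (hsize j)
    exact ⟨⟨y, Set.mem_iUnion_of_mem j hy⟩, x, Set.mem_iUnion_of_mem j hx⟩
  obtain ⟨σ, hσ⟩ := helem.exists_equiv (fun a => (htotal a).1.imp fun _ => Or.inr)
    fun a => (htotal a).2.imp fun _ => Or.inr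
  exact ⟨σ, fun b => hσ _ (Or.inl ⟨b, rfl⟩)⟩

end Homogeneity

section Ultrapower

/-- The ultrapower of `Y` along `U`. -/
abbrev Ultrapower {W : Type*} (U : Ultrafilter W) (Y : Type*) : Type _ :=
  (U : Filter W).Product fun _ => Y

/-- The element of the ultrapower represented by `f`. -/
def Ultrapower.mk {W Y : Type*} (U : Ultrafilter W) (f : W → Y) : Ultrapower U Y :=
  (f : (U : Filter W).Product fun _ => Y)

theorem Ultrapower.mk_surjective {W Y : Type*} (U : Ultrafilter W) :
    Function.Surjective (Ultrapower.mk U : (W → Y) → Ultrapower U Y) :=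
  Quotient.mk_surjective

variable {L : FirstOrder.Language.{u, v}} {Y : Type w} [L.Structure Y] [Nonempty Y]

theorem Ultrapower.realize_mk {W : Type*} (U : Ultrafilter W) {α : Type*} (φ : L.Formula α)
    (f : α → W → Y) :
    φ.Realize (fun i => Ultrapower.mk U (f i)) ↔ ∀ᶠ w in U, φ.Realize fun i => f i w :=
  Ultraproduct.realize_formula_cast φ f

/-- The diagonal embedding of a structure in its ultrapower. -/
def Ultrapower.diagonal {W : Type*} (U : Ultrafilter W) : Y ↪ₑ[L] Ultrapower U Y where
  toFun a := Ultrapower.mk U fun _ => a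
  map_formula' _ φ x := (Ultrapower.realize_mk U φ fun i _ => x i).trans Filter.eventually_const

theorem IsSaturated.exists_mem_of_neBot {κ : Cardinal.{w}} (hY : IsSaturated L κ Y)
    (hκ : ℵ₀ ≤ κ) {B : Set Y} (hB : #B < κ) {k : ℕ} (F : Filter (Fin k → Y)) [F.NeBot] :
    ∃ a, ∀ Z ∈ F, B.Definable L Z → a ∈ Z := by
  let U := Ultrafilter.of F
  have hdiag := sameType_embedding (Ultrapower.diagonal (L := L) U) fun b : B => (b : Y)
  obtain ⟨R, hsub, hR, hdom⟩ := (hdiag.isElementaryRel fun _ => id).exists_extend hY hκ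
    (Cardinal.mk_range_le.trans_lt hB) (S := Set.range fun i => Ultrapower.mk U fun y => y i)
    (((Set.finite_range _).lt_aleph0).trans_le hκ)
  choose a ha using fun i => hdom _ ⟨i, rfl⟩
  refine ⟨a, fun Z hZ hdef => ?_⟩
  obtain ⟨φ, rfl⟩ := Set.definable_iff_exists_formula_sum.1 hdef
  have hsame := hR.sameType
    (f := fun i => Ultrapower.mk U fun y => Sum.elim (fun b : B => (b : Y)) y i)
    (g := Sum.elim (fun b : B => (b : Y)) a) (Sum.rec (fun b => hsub ⟨b, rfl⟩) ha)
  exact (hsame φ).1 ((Ultrapower.realize_mk U φ _).2 (Ultrafilter.of_le F hZ))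

end Ultrapower

section SaturatedExtension

variable {L : FirstOrder.Language.{u, v}}

theorem definable_range_iff {X α β : Type*} [L.Structure X] {b : β → X} {Z : Set (α → X)} :
    (Set.range b).Definable L Z ↔ ∃ φ : L.Formula (β ⊕ α), Z = {a | φ.Realize (Sum.elim b a)} := by
  refine ⟨fun h => ?_, ?_⟩
  · obtain ⟨φ, rfl⟩ := Set.definable_iff_exists_formula_sum.1 h
    choose i hi using fun c : Set.range b => c.2
    refine ⟨φ.relabel (Sum.map i id), ?_⟩
    have hb : b ∘ i = Subtype.val := funext hi
    simp only [Formula.realize_relabel, Sum.elim_comp_map, hb, Function.comp_id]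
  · rintro ⟨φ, rfl⟩
    exact definable_setOf_realize Set.mem_range_self φ

theorem exists_isSaturated_elementarySubstructure {Y : Type w} [L.Structure Y] {κ : Cardinal.{w}}
    (hκ : ℵ₀ ≤ κ) {S : Set Y}
    (hS : ∀ B ⊆ S, #B < κ → ∀ F : Filter (Fin 1 → Y), F.NeBot →
      ∃ s ∈ S, ∀ Z ∈ F, B.Definable L Z → (fun _ => s) ∈ Z) :
    ∃ T : L.ElementarySubstructure Y, (T : Set Y) = S ∧ IsSaturated L κ T := by
  have hmeets : L.MeetsDefinable S := by
    rintro D ⟨x, hx⟩ hD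
    obtain ⟨B, hB, hDB⟩ := Set.definable_iff_finitely_definable.1 hD
    obtain ⟨s, hs, hsZ⟩ := hS B hB ((Cardinal.lt_aleph0_of_finite B).trans_le hκ)
      (Filter.principal {y | y 0 ∈ D}) (Filter.principal_neBot_iff.2 ⟨fun _ => x, hx⟩)
    exact ⟨s, hsZ _ (Filter.mem_principal_self _) hDB, hs⟩
  obtain ⟨T, rfl⟩ : ∃ T : L.ElementarySubstructure Y, (T : Set Y) = S :=
    ⟨hmeets.toElementarySubstructure, hmeets.closure_eq_self⟩
  refine ⟨T, rfl, isSaturated_iff_forall_filter.2 fun B hB F hF => ?_⟩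
  obtain ⟨s, hs, hsZ⟩ := hS (T.subtype '' B) (Set.image_subset_iff.2 fun b _ => b.2)
    (Cardinal.mk_image_le.trans_lt hB) (F.map fun x => T.subtype ∘ x) inferInstance
  refine ⟨fun _ => ⟨s, hs⟩, fun Z hZ hdef => ?_⟩
  obtain ⟨Z', hdef', hZ'⟩ := exists_definable_comp_mem_iff T.subtype hdef
  exact (hZ' _).1 (hsZ Z' (Filter.mem_map.2 (F.mem_of_superset hZ fun x => (hZ' x).2)) hdef')

variable {A C β : Type w} [L.Structure A]

/-- The set of those `w : C → A` for which `φ` holds of the elements coded by `b` and of `w c`,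
where `a : A` codes itself and `d : C` codes the value `w d`. -/
def solutionsAt (b : β → A ⊕ C) (c : C) (φ : L.Formula (β ⊕ Fin 1)) : Set (C → A) :=
  {w | φ.Realize (Sum.elim (fun i => Sum.elim id w (b i)) fun _ => w c)}

/-- The element of the ultrapower coded by `d`. -/
def Ultrapower.coded (U : Ultrafilter (C → A)) (d : A ⊕ C) : Ultrapower U A :=
  Ultrapower.mk U fun w => Sum.elim id w d

theorem sumElim_update_of_ne [DecidableEq C] {w : C → A} {c : C} {d : A ⊕ C}
    (hd : d ≠ Sum.inr c) (x : A) :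
    Sum.elim id (Function.update w c x) d = Sum.elim id w d := by
  rcases d with a | d
  · rfl
  · exact Function.update_of_ne (fun h => hd (congrArg _ h)) x w

theorem Ultrapower.realize_coded [Nonempty A] (U : Ultrafilter (C → A)) (b : β → A ⊕ C)
    (f : (C → A) → A) (φ : L.Formula (β ⊕ Fin 1)) :
    φ.Realize (Sum.elim (Ultrapower.coded U ∘ b) fun _ => Ultrapower.mk U f) ↔
      ∀ᶠ w in U, φ.Realize (Sum.elim (fun i => Sum.elim id w (b i)) fun _ => f w) := by
  convert Ultrapower.realize_mk U φ (Sum.elim (fun i w => Sum.elim id w (b i)) fun _ => f)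
    using 3 with i w
  · cases i <;> rfl
  · exact iff_of_eq (congrArg φ.Realize (funext fun i => by cases i <;> rfl))

/-- The sets which `w` has to belong to for `w c` to solve the task `e c = (b, Γ)`, which is to
realize the formulas in `Γ` with the parameters coded by `b`. There are none unless `b` only uses
values of `w` at indices below `c`. -/
def taskConditions [LT C] (e : C → (β → A ⊕ C) × Set (L.Formula (β ⊕ Fin 1))) (c : C) :
    Set (Set (C → A)) :=
  {Z | (∀ i d, (e c).1 i = Sum.inr d → d < c) ∧ ∃ φ ∈ (e c).2, Z = solutionsAt (e c).1 c φ}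

theorem update_mem_taskConditions_iff [LinearOrder C] [DecidableEq C]
    {e : C → (β → A ⊕ C) × Set (L.Formula (β ⊕ Fin 1))} {c d : C} (hd : d < c)
    {Z : Set (C → A)} (hZ : Z ∈ taskConditions e d) (w : C → A) (x : A) :
    Function.update w c x ∈ Z ↔ w ∈ Z := by
  obtain ⟨hfresh, φ, -, rfl⟩ := hZ
  have hb : ∀ i, Sum.elim id (Function.update w c x) ((e d).1 i) = Sum.elim id w ((e d).1 i) :=
    fun i => sumElim_update_of_ne (fun hi => (hfresh i c hi).not_gt hd) x
  simp only [solutionsAt, Set.mem_ofPred_eq, hb, Function.update_of_ne hd.ne]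

theorem neBot_generate_taskConditions [LinearOrder C] [Nonempty A] {U : Ultrafilter (C → A)}
    {e : C → (β → A ⊕ C) × Set (L.Formula (β ⊕ Fin 1))} {c : C} {b : β → A ⊕ C}
    {F : Filter (Fin 1 → Ultrapower U A)} [F.NeBot]
    (he : e c = (b, {φ | ∀ᶠ y in F, φ.Realize (Sum.elim (Ultrapower.coded U ∘ b) y)})) :
    (Filter.generate
      ({Z | Z ∈ U ∧ ∃ d < c, Z ∈ taskConditions e d} ∪ taskConditions e c)).NeBot := by
  classical
  refine Filter.generate_neBot_iff.2 fun t ht hfin => ?_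
  have hforall : ∀ Z ∈ t, ∀ᶠ y in F, ∀ f, Ultrapower.mk U f = y 0 →
      ∀ᶠ w in U, Function.update w c (f w) ∈ Z := by
    intro Z hZ
    rcases ht hZ with ⟨hZU, d, hd, hZd⟩ | ⟨hfresh, φ, hφ, rfl⟩
    · refine .of_forall fun y f _ => ?_
      filter_upwards [hZU] with w hw
      exact (update_mem_taskConditions_iff hd hZd w _).2 hw
    · rw [he] at hfresh hφ ⊢
      refine Filter.Eventually.mono hφ fun y hy f hf => ?_
      obtain rfl : (fun _ => Ultrapower.mk U f) = y :=
        funext fun i => hf.trans (congrArg y (Subsingleton.elim 0 i))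
      filter_upwards [(Ultrapower.realize_coded U b f φ).1 hy] with w hw
      have hb : ∀ i, Sum.elim id (Function.update w c (f w)) (b i) = Sum.elim id w (b i) :=
        fun i => sumElim_update_of_ne (fun hi => (hfresh i c hi).false) _
      simpa only [solutionsAt, Set.mem_ofPred_eq, hb, Function.update_self] using hw
  obtain ⟨y, hy⟩ := ((Filter.eventually_all_finite hfin).2 hforall).exists
  obtain ⟨f, hf⟩ := Ultrapower.mk_surjective U (y 0)
  obtain ⟨w, hw⟩ := ((Filter.eventually_all_finite hfin).2 fun Z hZ => hy Z hZ f hf).exists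
  exact ⟨_, fun Z hZ => hw Z hZ⟩

theorem exists_forall_inr_lt [LinearOrder C] (hβ : #β < Order.cof C) (b : β → A ⊕ C) :
    ∃ c, ∀ i d, b i = Sum.inr d → d < c := by
  have hcof : ¬ IsCofinal (Sum.inr ⁻¹' Set.range b : Set C) := fun h => (Order.cof_le h).not_gt
    ((Cardinal.mk_preimage_of_injective _ _ Sum.inr_injective).trans_lt
      (Cardinal.mk_range_le.trans_lt hβ))
  exact (not_isCofinal_iff.1 hcof).imp fun c hc i d hi => hc d ⟨i, hi⟩

theorem exists_ultrafilter_coded [LinearOrder C] [WellFoundedLT C] [Nonempty A]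
    (hβ : #β < Order.cof C) {e : C → (β → A ⊕ C) × Set (L.Formula (β ⊕ Fin 1))}
    (he : ∀ x c₀, ∃ c, c₀ < c ∧ e c = x) :
    ∃ U : Ultrafilter (C → A), ∀ (b : β → A ⊕ C) (F : Filter (Fin 1 → Ultrapower U A)), F.NeBot →
      ∃ c, ∀ Z ∈ F, (Set.range (Ultrapower.coded U ∘ b)).Definable L Z →
        (fun _ => Ultrapower.coded U (Sum.inr c)) ∈ Z := by
  obtain ⟨U, hU⟩ := exists_greedy_ultrafilter (taskConditions e)
  refine ⟨U, fun b F hF => ?_⟩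
  obtain ⟨c₀, hc₀⟩ := exists_forall_inr_lt hβ b
  obtain ⟨c, hc, hec⟩ :=
    he (b, {φ | ∀ᶠ y in F, φ.Realize (Sum.elim (Ultrapower.coded U ∘ b) y)}) c₀
  refine ⟨c, fun Z hZ hdef => ?_⟩
  obtain ⟨φ, rfl⟩ := definable_range_iff.1 hdef
  refine (Ultrapower.realize_coded U b (fun w => w c) φ).2
    (hU c (neBot_generate_taskConditions hec) (solutionsAt b c φ) ?_)
  rw [taskConditions, hec]
  exact ⟨fun i d hi => (hc₀ i d hi).trans hc, φ, hZ, rfl⟩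

theorem exists_subset_range_comp {X D : Type*} [Nonempty β] [Nonempty D] (v : D → X)
    {B : Set X} (hB : B ⊆ Set.range v) (hβ : Nonempty (B ↪ β)) :
    ∃ b : β → D, B ⊆ Set.range (v ∘ b) := by
  obtain ⟨j⟩ := hβ
  choose k hk using fun x : B => hB x.2
  exact ⟨Function.extend j k fun _ => Classical.arbitrary D, fun x hx =>
    ⟨j ⟨x, hx⟩, by rw [Function.comp_apply, j.injective.extend_apply, hk]⟩⟩

theorem exists_cofinal_enumeration {D : Type*} [Nonempty D] {ν : Cardinal.{w}} (hν : ℵ₀ ≤ ν)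
    (hD : Nonempty (D ↪ ν.ord.ToType)) :
    ∃ e : ν.ord.ToType → D, ∀ d c₀, ∃ c, c₀ < c ∧ e c = d := by
  obtain ⟨j⟩ := hD
  obtain ⟨p⟩ : Nonempty (ν.ord.ToType ≃ ν.ord.ToType × ν.ord.ToType) := by
    rw [← Cardinal.eq, Cardinal.mk_prod, Cardinal.lift_id, Cardinal.mk_ord_toType,
      Cardinal.mul_eq_self hν]
  refine ⟨fun c => Function.invFun j (p c).2, fun d c₀ => ?_⟩
  by_contra! hbounded
  have hmem : ∀ c, p.symm (c, j d) ∈ Set.Iic c₀ := fun c => not_lt.1 fun hlt =>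
    hbounded _ hlt (by simp [Function.leftInverse_invFun j.injective d])
  have hinj : Function.Injective fun c => (⟨p.symm (c, j d), hmem c⟩ : Set.Iic c₀) :=
    fun c c' h => by simpa using h
  have hlt : #(Set.Iic c₀) < ν := by
    rw [← Set.Iio_insert]
    exact Cardinal.mk_insert_le.trans_lt (Cardinal.add_lt_of_lt hν
      (by simpa using Cardinal.mk_Iio_lt c₀) (Cardinal.one_lt_aleph0.trans_le hν))
  exact hlt.not_ge ((Cardinal.mk_ord_toType ν).symm.le.trans (Cardinal.mk_le_of_injective hinj))

variable {μ : Cardinal.{w}}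

theorem card_formula_le {I : Type w} (hμ : ℵ₀ ≤ μ) (hI : #I ≤ μ)
    (hL : Cardinal.lift.{w} L.card ≤ Cardinal.lift.{max u v} μ) :
    #(L.Formula I) ≤ Cardinal.lift.{max u v} μ := by
  have hbounded : #(L.Formula I) ≤ #(Σ n, L.BoundedFormula I n) :=
    Cardinal.mk_le_of_injective (sigma_mk_injective (β := L.BoundedFormula I) (i := 0))
  exact hbounded.trans (BoundedFormula.card_le.trans (max_le (by simpa using hμ)
    (Cardinal.add_le_of_le (by simpa using hμ) (Cardinal.lift_le.2 hI) hL)))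

theorem card_setFormula_le {I : Type w} (hμ : ℵ₀ ≤ μ) (hI : #I ≤ μ)
    (hL : Cardinal.lift.{w} L.card ≤ Cardinal.lift.{max u v} μ) :
    #(Set (L.Formula I)) ≤ Cardinal.lift.{max u v} (2 ^ μ) := by
  rw [Cardinal.mk_set, Cardinal.lift_two_power]
  exact Cardinal.power_le_power_left two_ne_zero (card_formula_le hμ hI hL)

theorem mk_arrow_le_two_power {D : Type w} (hμ : ℵ₀ ≤ μ) (hD : #D ≤ 2 ^ μ) :
    #(μ.out → D) ≤ 2 ^ μ := by
  rw [← Cardinal.power_def, Cardinal.mk_out]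
  refine (Cardinal.power_le_power_right hD).trans ?_
  rw [← Cardinal.power_mul, Cardinal.mul_eq_self hμ]

theorem nonempty_task_embedding {D : Type w} (hμ : ℵ₀ ≤ μ) (hD : #D ≤ 2 ^ μ)
    (hL : Cardinal.lift.{w} L.card ≤ Cardinal.lift.{max u v} μ) :
    Nonempty ((μ.out → D) × Set (L.Formula (μ.out ⊕ Fin 1)) ↪
      ((2 : Cardinal.{w}) ^ μ).ord.ToType) := by
  have hν : ℵ₀ ≤ (2 : Cardinal.{w}) ^ μ := hμ.trans (Cardinal.cantor μ).le
  have hI : #(μ.out ⊕ Fin 1) ≤ μ := by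
    simpa using Cardinal.add_le_of_le hμ le_rfl (Cardinal.one_le_aleph0.trans hμ)
  rw [← Cardinal.lift_mk_le'.{max u v w, w}, Cardinal.mk_prod, Cardinal.mk_ord_toType]
  simp only [Cardinal.lift_mul, Cardinal.lift_lift]
  refine Cardinal.mul_le_of_le (Cardinal.aleph0_le_lift.2 hν) ?_ ?_
  · simpa using Cardinal.lift_le.{max u v w}.2 (mk_arrow_le_two_power hμ hD)
  · simpa using Cardinal.lift_le.{w}.2 (card_setFormula_le hμ hI hL)

theorem exists_saturated_extension [Nonempty A] (hμ : ℵ₀ ≤ μ) (hA : #A ≤ 2 ^ μ)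
    (hL : Cardinal.lift.{w} L.card ≤ Cardinal.lift.{max u v} μ) :
    ∃ (S : Type w) (_ : L.Structure S), #S ≤ 2 ^ μ ∧ IsSaturated L (Order.succ μ) S ∧
      Nonempty (A ↪ₑ[L] S) := by
  have hν : ℵ₀ ≤ (2 : Cardinal.{w}) ^ μ := hμ.trans (Cardinal.cantor μ).le
  let C := ((2 : Cardinal.{w}) ^ μ).ord.ToType
  have hcodes : #(A ⊕ C) ≤ 2 ^ μ := by
    rw [Cardinal.mk_sum, Cardinal.lift_id, Cardinal.lift_id, Cardinal.mk_ord_toType]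
    exact Cardinal.add_le_of_le hν hA le_rfl
  have hcof : #μ.out < Order.cof C := by
    rw [Cardinal.mk_out, Ordinal.cof_toType]
    exact Cardinal.lt_cof_ord_power hμ Cardinal.one_lt_two
  obtain ⟨e, he⟩ := exists_cofinal_enumeration hν (nonempty_task_embedding (L := L) hμ hcodes hL)
  obtain ⟨U, hU⟩ := exists_ultrafilter_coded (A := A) hcof he
  have : Nonempty μ.out := Cardinal.mk_ne_zero_iff.1 (by
    rw [Cardinal.mk_out]; exact (Cardinal.aleph0_pos.trans_le hμ).ne')
  obtain ⟨S, hS, hsat⟩ := exists_isSaturated_elementarySubstructure (L := L)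
    (hμ.trans (Order.le_succ μ)) (S := Set.range (Ultrapower.coded U)) fun B hB hBμ F hF => by
      obtain ⟨b, hb⟩ := exists_subset_range_comp (β := μ.out) _ hB (by
        rw [← Cardinal.le_def, Cardinal.mk_out]; exact Order.lt_succ_iff.1 hBμ)
      obtain ⟨c, hc⟩ := hU b F hF
      exact ⟨_, ⟨_, rfl⟩, fun Z hZ hdef => hc Z hZ (hdef.mono hb)⟩
  have hmem : ∀ x, x ∈ S ↔ x ∈ Set.range (Ultrapower.coded U) := fun x => by
    rw [← hS, SetLike.mem_coe]
  refine ⟨S, inferInstance, ?_, hsat, ⟨⟨fun a => ⟨Ultrapower.coded U (Sum.inl a),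
    (hmem _).2 ⟨_, rfl⟩⟩, fun n φ x => ?_⟩⟩⟩
  · exact (Cardinal.mk_congr (Equiv.setCongr hS)).le.trans (Cardinal.mk_range_le.trans hcodes)
  · rw [← S.subtype.map_formula]
    exact (Ultrapower.diagonal (L := L) U).map_formula φ x

end SaturatedExtension

section Models

variable {L : FirstOrder.Language.{u, v}} {Mbar : Type w} [L.Structure Mbar]
  {κ l : Cardinal.{w}}

theorem exists_elementarySubstructure_card_le (hl : ℵ₀ ≤ l)
    (hL : Cardinal.lift.{w} L.card ≤ Cardinal.lift.{max u v} l) {s : Set Mbar} (hs : #s ≤ l) :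
    ∃ A : L.ElementarySubstructure Mbar, s ⊆ A ∧ #A ≤ l := by
  rcases le_total #Mbar l with h | h
  · exact ⟨⊤, fun _ _ => trivial, (Cardinal.mk_subtype_le _).trans h⟩
  · obtain ⟨A, hA, hcard⟩ := exists_elementarySubstructure_card_eq L s l hl (by simpa using hs)
      hL (by simpa using h)
    exact ⟨A, hA, by simpa using hcard.le⟩

theorem mk_elementaryRange_le {S : Type w} [L.Structure S] (g : S ↪ₑ[L] Mbar) :
    #(elementaryRange g) ≤ #S :=
  Cardinal.mk_le_of_surjective (equivElementaryRange g).surjective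

theorem exists_saturated_elementarySubstructure [Nonempty Mbar] (hsat : IsSaturated L κ Mbar)
    (hl : ℵ₀ ≤ l) (hL : Cardinal.lift.{w} L.card ≤ Cardinal.lift.{max u v} l) (hκ : 2 ^ l < κ)
    {s : Set Mbar} (hs : #s ≤ l) :
    ∃ M' : L.ElementarySubstructure Mbar, s ⊆ M' ∧ #M' ≤ 2 ^ l ∧
      IsSaturated L (Order.succ l) M' := by
  obtain ⟨A, hsA, hA⟩ := exists_elementarySubstructure_card_le hl hL hs
  obtain ⟨S, _, hS, hSsat, ⟨f⟩⟩ := exists_saturated_extension hl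
    (hA.trans (Cardinal.cantor l).le) hL
  obtain ⟨g, hg⟩ := hsat.exists_comp_eq (hl.trans ((Cardinal.cantor l).trans hκ).le)
    (hS.trans_lt hκ) f A.subtype
  refine ⟨elementaryRange g, fun x hx => ?_, (mk_elementaryRange_le g).trans hS,
    hSsat.of_equiv (equivElementaryRange g)⟩
  rw [coe_elementaryRange]
  exact ⟨f ⟨x, hsA hx⟩, hg _⟩

/-- An elementary embedding for a richer language, as an elementary embedding of the reducts. -/
def reductEmbedding {L' : FirstOrder.Language.{u, v}} (φ : L →ᴸ L') {X Y : Type*} [L.Structure X]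
    [L'.Structure X] [φ.IsExpansionOn X] [L.Structure Y] [L'.Structure Y] [φ.IsExpansionOn Y]
    (f : X ↪ₑ[L'] Y) : X ↪ₑ[L] Y where
  toFun := f
  map_formula' n ψ x := by
    simpa only [LHom.realize_onFormula] using f.map_formula (φ.onFormula ψ) x

section PairLanguage

variable (L) in
/-- The interpretation of the predicate `P`. -/
def predSet (S : Type*) [(pairLanguage L).Structure S] : Set S :=
  {x | Structure.RelMap (L := pairLanguage L) (M := S) (n := 1) (Sum.inr PredSymbol.P) fun _ => x}

/-- The image of an `L_P`-structure under an elementary embedding of its reduct to `L`, as a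
pair. -/
noncomputable def equivPairIn {S : Type w} [L.Structure S] [(pairLanguage L).Structure S]
    [(LHom.sumInl : L →ᴸ pairLanguage L).IsExpansionOn S] (g : S ↪ₑ[L] Mbar) :
    S ≃[pairLanguage L] pairIn (elementaryRange g) (g '' predSet L S) where
  toEquiv := (equivElementaryRange g).toEquiv
  map_fun' := by
    rintro n (F | F) x
    · exact (congrArg (equivElementaryRange g) (LHom.map_onFunction LHom.sumInl F x)).trans
        ((equivElementaryRange g).map_fun F x)
    · exact nomatch F
  map_rel' := by
    rintro n (r | r) x
    · exact ((equivElementaryRange g).map_rel r x).trans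
        (iff_of_eq (LHom.map_onRelation LHom.sumInl r x).symm)
    · obtain ⟨⟩ := r
      obtain ⟨y, rfl⟩ : ∃ y, (fun _ => y) = x :=
        ⟨x 0, funext fun i => congrArg x (Subsingleton.elim 0 i)⟩
      exact g.injective.mem_set_image

theorem card_pairLanguage_le (hl : ℵ₀ ≤ l)
    (hL : Cardinal.lift.{w} L.card ≤ Cardinal.lift.{max u v} l) :
    Cardinal.lift.{w} (pairLanguage L).card ≤ Cardinal.lift.{max u v} l := by
  have hpred : predLanguage.card ≤ 1 := by
    refine Cardinal.le_one_iff_subsingleton.2 ⟨?_⟩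
    rintro (⟨_, ⟨⟩⟩ | ⟨_, ⟨⟩⟩) (⟨_, ⟨⟩⟩ | ⟨_, ⟨⟩⟩)
    rfl
  have hl' : 1 ≤ Cardinal.lift.{max u v} l := by simpa using Cardinal.one_le_aleph0.trans hl
  rw [pairLanguage, Language.card_sum, Cardinal.lift_add]
  refine Cardinal.add_le_of_le (by simpa using hl) (by simpa using hL) (le_trans ?_ hl')
  simpa using Cardinal.lift_le.{max u v w}.2 hpred

end PairLanguage

theorem exists_simonPair [Nonempty Mbar] (hsat : IsSaturated L κ Mbar)
    (hl : ℵ₀ ≤ l) (hL : Cardinal.lift.{w} L.card ≤ Cardinal.lift.{max u v} l)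
    (hκ : 2 ^ (2 : Cardinal.{w}) ^ l < κ) {M : L.ElementarySubstructure Mbar} (hM : #M ≤ l)
    (s : Finset Mbar) : ∃ D : SimonPair M, (s : Set Mbar) ⊆ D.M' := by
  have h2l : ℵ₀ ≤ (2 : Cardinal.{w}) ^ l := hl.trans (Cardinal.cantor l).le
  have h2κ : (2 : Cardinal.{w}) ^ l < κ := (Cardinal.cantor _).trans hκ
  obtain ⟨M', hsM', hM', hM'sat⟩ := exists_saturated_elementarySubstructure hsat hl hL h2κ
    (s := (M : Set Mbar) ∪ s) ((Cardinal.mk_union_le _ _).trans (Cardinal.add_le_of_le hl hM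
      ((Cardinal.lt_aleph0_of_finite s).le.trans hl)))
  have : Nonempty (pairIn M' (M : Set Mbar)) := inferInstanceAs (Nonempty M')
  obtain ⟨S, _, hS, hSsat, ⟨f⟩⟩ := exists_saturated_extension (L := pairLanguage L)
    (A := pairIn M' (M : Set Mbar)) h2l (hM'.trans (Cardinal.cantor _).le)
    (card_pairLanguage_le h2l (hL.trans (Cardinal.lift_le.2 (Cardinal.cantor l).le)))
  let _ : L.Structure S := LHom.sumInl.reduct (L' := pairLanguage L) S
  have : (LHom.sumInl : L →ᴸ pairLanguage L).IsExpansionOn S := LHom.isExpansionOn_reduct _ _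
  obtain ⟨g, hg⟩ := hsat.exists_comp_eq (h2l.trans h2κ.le) (hS.trans_lt hκ)
    (reductEmbedding LHom.sumInl f) (show pairIn M' (M : Set Mbar) ↪ₑ[L] Mbar from M'.subtype)
  refine ⟨⟨M', elementaryRange g, g '' predSet L S, Set.subset_union_left.trans hsM',
    hM'sat.mono (Order.succ_le_succ hM), ?_,
    ⟨(equivPairIn g).toElementaryEmbedding.comp f, hg⟩,
    (hSsat.mono (Order.succ_le_succ hM')).of_equiv (equivPairIn g)⟩,
    Set.subset_union_right.trans hsM'⟩
  rw [coe_elementaryRange]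
  exact Set.image_subset_range g _

end Models

section Pairs

variable {L : FirstOrder.Language.{u, v}} {Mbar : Type w} [L.Structure Mbar] {α β γ : Type*}

/-- The `α`-tuples of elements of `N`. -/
def tuples (N : Set Mbar) (α : Type*) : Set (α → Mbar) := {a | ∀ i, a i ∈ N}

theorem inter_tuples_nonempty_of_definable [Finite β] (M : L.ElementarySubstructure Mbar)
    {Z : Set (β → Mbar)} (hZ : (M : Set Mbar).Definable L Z) (hne : Z.Nonempty) :
    (Z ∩ tuples (M : Set Mbar) β).Nonempty := by
  obtain ⟨φ, rfl⟩ := Set.definable_iff_exists_formula_sum.1 hZ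
  obtain ⟨x, hx⟩ := hne
  obtain ⟨y, hy⟩ := Formula.realize_iExs.1
    ((M.subtype.map_formula (φ.iExs β) id).1 (Formula.realize_iExs.2 ⟨x, hx⟩))
  refine ⟨M.subtype ∘ y, ?_, fun j => (y j).2⟩
  have := (M.subtype.map_formula φ _).2 hy
  rwa [Sum.comp_elim] at this

theorem definable_setOf_sumElim_mem {B : Set Mbar} {R : Set (β ⊕ α → Mbar)}
    (hR : B.Definable L R) {b : β → Mbar} (hb : ∀ i, b i ∈ B) :
    B.Definable L {a | Sum.elim b a ∈ R} := by
  obtain ⟨φ, rfl⟩ := Set.definable_iff_exists_formula_sum.1 hR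
  convert definable_setOf_realize (b := Sum.elim ((↑) : B → Mbar) b)
    (Sum.forall.2 ⟨fun c => c.2, hb⟩) (φ.relabel (Equiv.sumAssoc B β α).symm) using 2
  ext a
  simp only [Set.mem_ofPred_eq, Formula.realize_relabel]
  exact iff_of_eq (congrArg φ.Realize (by ext (i | i | i) <;> rfl))

theorem exists_eq_setOf_sumElim_mem {B : Set Mbar} {X : Set (α → Mbar)} (hX : B.Definable L X) :
    ∃ (l : ℕ) (b : Fin l → Mbar), (∀ i, b i ∈ B) ∧ ∃ R : Set (Fin l ⊕ α → Mbar),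
      (∅ : Set Mbar).Definable L R ∧ X = {a | Sum.elim b a ∈ R} := by
  obtain ⟨s, hs, hX⟩ := Set.definable_iff_finitely_definable.1 hX
  have hrange : Set.range (((↑) : s → Mbar) ∘ s.equivFin.symm) = s := by
    rw [EquivLike.range_comp, Subtype.range_coe_subtype, Finset.setOfPred_mem]
  rw [← hrange] at hX
  obtain ⟨φ, rfl⟩ := definable_range_iff.1 hX
  exact ⟨s.card, _, fun i => hs (s.equivFin.symm i).2, {c | φ.Realize c},
    Set.empty_definable_iff.2 ⟨φ, rfl⟩, rfl⟩

/-- The inclusion of the pair `(A, S)` into the ambient model. -/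
def pairSubtype (A : L.ElementarySubstructure Mbar) (S : Set Mbar) : pairIn A S ↪ₑ[L] Mbar :=
  A.subtype

theorem range_pairSubtype (A : L.ElementarySubstructure Mbar) (S : Set Mbar) :
    Set.range (pairSubtype A S) = A :=
  Subtype.range_coe

/-- A formula of `L` as a formula of the language of pairs. -/
def toPair (φ : L.Formula α) : (pairLanguage L).Formula α :=
  LHom.sumInl.onFormula φ

variable (L) in
/-- The formula `P(x)`. -/
def inPred (i : α) : (pairLanguage L).Formula α :=
  Relations.formula₁ (L := pairLanguage L) (Sum.inr PredSymbol.P) (Term.var i)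

/-- The formula `∃ x, P(x) ∧ φ(c, x)`. -/
noncomputable def existsInPred [Finite β] (φ : (pairLanguage L).Formula (γ ⊕ β)) :
    (pairLanguage L).Formula γ :=
  ((Formula.iInf fun j : β => inPred L (Sum.inr j)) ⊓ φ).iExs β

section Realize

variable {A : L.ElementarySubstructure Mbar} {S : Set Mbar}

theorem realize_toPair (φ : L.Formula α) (x : α → pairIn A S) :
    (toPair φ).Realize x ↔ φ.Realize (pairSubtype A S ∘ x) :=
  (LHom.realize_onFormula _ φ).trans ((pairSubtype A S).map_formula φ x).symm

theorem realize_inPred (i : α) (x : α → pairIn A S) :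
    (inPred L i).Realize x ↔ pairSubtype A S (x i) ∈ S :=
  Formula.realize_rel₁

theorem realize_existsInPred [Finite β] (φ : (pairLanguage L).Formula (γ ⊕ β))
    (c : γ → pairIn A S) : (existsInPred φ).Realize c ↔
      ∃ x : β → pairIn A S, pairSubtype A S ∘ x ∈ tuples S β ∧ φ.Realize (Sum.elim c x) := by
  simp only [existsInPred, Formula.realize_iExs, Formula.realize_inf, Formula.realize_iInf,
    realize_inPred]
  rfl

theorem exists_pairSubtype_comp_eq (hS : S ⊆ A) {x : β → Mbar} (hx : x ∈ tuples S β) :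
    ∃ y : β → pairIn A S, pairSubtype A S ∘ y = x :=
  ⟨fun j => PairOf.ofBase _ ⟨x j, hS (hx j)⟩, rfl⟩

theorem realize_existsInPred_toPair [Finite β] (hS : S ⊆ A) (φ : L.Formula (γ ⊕ β))
    (c : γ → pairIn A S) : (existsInPred (toPair φ)).Realize c ↔
      ∃ x ∈ tuples S β, φ.Realize (Sum.elim (pairSubtype A S ∘ c) x) := by
  simp only [realize_existsInPred, realize_toPair, Sum.comp_elim]
  refine ⟨fun ⟨x, hx⟩ => ⟨_, hx⟩, fun ⟨x, hxS, hx⟩ => ?_⟩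
  obtain ⟨y, rfl⟩ := exists_pairSubtype_comp_eq hS hxS
  exact ⟨y, hxS, hx⟩

end Realize

namespace SimonPair

variable {M : L.ElementarySubstructure Mbar} (D : SimonPair M)

theorem exists_embedding : ∃ f : pairIn D.M' (M : Set Mbar) ↪ₑ[pairLanguage L] pairIn D.N' D.N,
    pairSubtype D.N' D.N ∘ f = pairSubtype D.M' (M : Set Mbar) :=
  D.elementary.imp fun _ hf => funext hf

theorem M'_subset_N' : (D.M' : Set Mbar) ⊆ D.N' := by
  obtain ⟨f, hf⟩ := D.exists_embedding
  rw [← range_pairSubtype D.M' M, ← range_pairSubtype D.N' D.N, ← hf]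
  exact Set.range_comp_subset_range _ _

theorem subset_N : (M : Set Mbar) ⊆ D.N := by
  intro x hx
  obtain ⟨f, hf⟩ := D.exists_embedding
  let c : Unit → pairIn D.M' (M : Set Mbar) := fun _ => PairOf.ofBase _ ⟨x, D.M_le hx⟩
  have h := (f.map_formula (inPred L ()) c).2 ((realize_inPred () c).2 hx)
  rw [realize_inPred] at h
  exact (show pairSubtype D.N' D.N ((f ∘ c) ()) = x from congrFun hf (c ())) ▸ h

theorem inter_tuples_nonempty [Finite β] {Y : Set (β → Mbar)}
    (hY : (D.M' : Set Mbar).Definable L Y) (h : (Y ∩ tuples D.N β).Nonempty) :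
    (Y ∩ tuples (M : Set Mbar) β).Nonempty := by
  obtain ⟨f, hf⟩ := D.exists_embedding
  rw [← range_pairSubtype D.M' M] at hY
  obtain ⟨φ, rfl⟩ := definable_range_iff.1 hY
  have key := f.map_formula (existsInPred (toPair φ)) id
  rw [realize_existsInPred_toPair D.N_sub, realize_existsInPred_toPair D.M_le, Function.comp_id,
    hf, Function.comp_id] at key
  obtain ⟨x, hx, hxN⟩ := h
  obtain ⟨y, hyM, hy⟩ := key.1 ⟨x, hxN, hx⟩
  exact ⟨y, hy, hyM⟩

theorem transfer_exists_sumElim_mem [Finite β] [Finite γ] {Y : Set (γ ⊕ β → Mbar)}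
    (hY : (D.M' : Set Mbar).Definable L Y)
    (h : ∀ c ∈ tuples (M : Set Mbar) γ, (∃ x, Sum.elim c x ∈ Y) →
      ∃ x ∈ tuples (M : Set Mbar) β, Sum.elim c x ∈ Y) :
    ∀ c ∈ tuples D.N γ, (∃ x, Sum.elim c x ∈ Y) → ∃ x ∈ tuples D.N β, Sum.elim c x ∈ Y := by
  obtain ⟨f, hf⟩ := D.exists_embedding
  rw [← range_pairSubtype D.M' M] at hY
  obtain ⟨φ, rfl⟩ := definable_range_iff.1 hY
  set σ := φ.relabel (Equiv.sumAssoc (pairIn D.M' (M : Set Mbar)) γ β).symm with hσ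
  have hmem : ∀ c x, σ.Realize (Sum.elim (Sum.elim (pairSubtype D.M' (M : Set Mbar)) c) x) ↔
      Sum.elim c x ∈ {a | φ.Realize (Sum.elim (pairSubtype D.M' (M : Set Mbar)) a)} := by
    intro c x
    rw [hσ, Formula.realize_relabel, Set.mem_ofPred_eq]
    exact iff_of_eq (congrArg φ.Realize (by ext (i | i | i) <;> rfl))
  have key := f.map_formula
    (existsInPred (toPair (σ.iExs β) ⊓ (existsInPred (toPair σ)).not)) id
  simp only [realize_existsInPred, Formula.realize_inf, Formula.realize_not,
    realize_existsInPred_toPair D.N_sub, realize_existsInPred_toPair D.M_le, realize_toPair,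
    Sum.comp_elim, Function.comp_id, hf, Formula.realize_iExs, hmem] at key
  intro c hc hx
  by_contra hn
  obtain ⟨c, rfl⟩ := exists_pairSubtype_comp_eq D.N_sub hc
  obtain ⟨c', hc', hx', hn'⟩ := key.1 ⟨c, hc, hx, hn⟩
  exact hn' (h _ hc' hx')

theorem tuples_inter_nonempty [Finite β] {X : Set (β → Mbar)} (hX : D.N.Definable L X)
    (h : X.Nonempty) : (X ∩ tuples D.N β).Nonempty := by
  obtain ⟨l, b, hb, R, hR, rfl⟩ := exists_eq_setOf_sumElim_mem hX
  obtain ⟨x, hxN, hx⟩ := D.transfer_exists_sumElim_mem (hR.mono (Set.empty_subset _))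
    (fun c hc hne => (inter_tuples_nonempty_of_definable M (definable_setOf_sumElim_mem
      (hR.mono (Set.empty_subset _)) hc) hne).imp fun _ hx => ⟨hx.2, hx.1⟩) b hb h
  exact ⟨x, hx, hxN⟩

theorem exists_mem_tuples_of_neBot [Nonempty Mbar] (hM' : ℵ₀ ≤ #D.M') {B : Set Mbar}
    (hBN : B ⊆ D.N') (hB : #B ≤ #D.M') {k : ℕ} (F : Filter (Fin k → Mbar)) [F.NeBot]
    (hF : tuples D.N (Fin k) ∈ F) :
    ∃ a ∈ tuples D.N (Fin k), ∀ Z ∈ F, B.Definable L Z → a ∈ Z := by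
  let g := pairSubtype D.N' D.N
  have : Nonempty (pairIn D.N' D.N) := inferInstanceAs (Nonempty D.N')
  have hgB : g '' (g ⁻¹' B) = B :=
    Set.image_preimage_eq_of_subset (by rwa [range_pairSubtype])
  have : (F.comap (g ∘ · : (Fin k → pairIn D.N' D.N) → Fin k → Mbar)).NeBot :=
    Filter.comap_neBot_iff.2 fun Z hZ => by
      obtain ⟨x, hxZ, hxN⟩ := Filter.nonempty_of_mem (Filter.inter_mem hZ hF)
      obtain ⟨y, rfl⟩ := exists_pairSubtype_comp_eq D.N_sub hxN
      exact ⟨y, hxZ⟩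
  obtain ⟨a, ha⟩ := D.saturated_pair.exists_mem_of_neBot (hM'.trans (Order.le_succ _))
    (B := g ⁻¹' B)
    (Order.lt_succ_iff.2 ((Cardinal.mk_preimage_of_injective _ _ g.injective).trans hB))
    (F.comap (g ∘ ·))
  refine ⟨g ∘ a, ha _ (Filter.preimage_mem_comap hF) ?_, fun Z hZ hdef =>
    ha _ (Filter.preimage_mem_comap hZ)
      ((definable_setOf_comp_mem g (hgB.symm ▸ hdef)).map_expansion LHom.sumInl)⟩
  refine Set.Definable.mono (Set.empty_definable_iff.2
    ⟨Formula.iInf fun j => inPred L j, ?_⟩) (Set.empty_subset _)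
  ext x
  simp only [Set.mem_ofPred_eq, Formula.realize_iInf, realize_inPred]
  rfl

end SimonPair

end Pairs

section Morley

variable {L : FirstOrder.Language.{u, v}} {Mbar : Type w} [L.Structure Mbar] {n : ℕ}
  {κ : Cardinal.{w}} {M : L.ElementarySubstructure Mbar}

/-- Invariance over `M` of an ultrafilter `U` on tuples: if the finite tuples `b` and `b'` have
the same type over `M`, then `U` contains a set definable with parameters in `M ∪ b` iff it
contains the corresponding set for `b'`. One implication suffices, as `U` is an ultrafilter. -/
def InvariantOver (M : L.ElementarySubstructure Mbar) (U : Ultrafilter (Fin n → Mbar)) : Prop :=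
  ∀ (γ : Type) [Finite γ] (b b' : γ → Mbar),
    (∀ Z : Set (γ → Mbar), (M : Set Mbar).Definable L Z → b ∈ Z → b' ∈ Z) →
    ∀ R : Set (γ ⊕ Fin n → Mbar), (M : Set Mbar).Definable L R →
      {a | Sum.elim b a ∈ R} ∈ U → {a | Sum.elim b' a ∈ R} ∈ U

theorem invariantOver_of_tuples_mem {U : Ultrafilter (Fin n → Mbar)}
    (h : tuples (M : Set Mbar) (Fin n) ∈ U) : InvariantOver M U := by
  intro γ _ b b' hb R hR hbR
  filter_upwards [hbR, h] with a ha haM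
  have hdef := definable_setOf_sumElim_mem (hR.preimage_comp Sum.swap) haM
  have hmem : ∀ c : γ → Mbar, c ∈ {c | Sum.elim a c ∈ {x | x ∘ Sum.swap ∈ R}} ↔
      Sum.elim c a ∈ R := fun c => iff_of_eq (congrArg (· ∈ R) (Sum.elim_swap))
  exact (hmem b').1 (hb _ hdef ((hmem b).2 ha))

variable (L) in
/-- `a` is a Morley sequence over `B` of the ultrafilter `U`: each `a i` satisfies the formulas of
`U` with parameters in `B` and the previous tuples. -/
def IsMorleySeq (B : Set Mbar) (U : Ultrafilter (Fin n → Mbar)) (a : ℕ → Fin n → Mbar) : Prop :=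
  ∀ i, ∀ X ∈ U, (B ∪ ⋃ j < i, Set.range (a j)).Definable L X → a i ∈ X

theorem IsMorleySeq.mem_of_mem {U : Ultrafilter (Fin n → Mbar)} {a a' : ℕ → Fin n → Mbar}
    (ha : IsMorleySeq L M U a) (ha' : IsMorleySeq L M U a') (hU : InvariantOver M U) {k : ℕ} :
    ∀ R : Set (Fin k × Fin n → Mbar), (M : Set Mbar).Definable L R →
      (fun p => a p.1 p.2) ∈ R → (fun p => a' p.1 p.2) ∈ R := by
  induction k with
  | zero => exact fun R _ h => by convert h using 2 with p; exact p.1.elim0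
  | succ k ih =>
    intro R hR
    let e : Fin (k + 1) × Fin n → (Fin k × Fin n) ⊕ Fin n := fun p =>
      Fin.lastCases (Sum.inr p.2) (fun i => Sum.inl (i, p.2)) p.1
    have hR' : (M : Set Mbar).Definable L {z | z ∘ e ∈ R} := hR.preimage_comp e
    have hsplit : ∀ a : ℕ → Fin n → Mbar,
        (Sum.elim (fun p : Fin k × Fin n => a p.1 p.2) (a k)) ∘ e = fun p => a p.1 p.2 := by
      intro a
      ext ⟨i, j⟩
      refine Fin.lastCases ?_ (fun i => ?_) i <;> simp [e]
    have hdef : ∀ a : ℕ → Fin n → Mbar, ((M : Set Mbar) ∪ ⋃ j < k, Set.range (a j)).Definable L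
        {x | Sum.elim (fun p : Fin k × Fin n => a p.1 p.2) x ∘ e ∈ R} := fun a =>
      definable_setOf_sumElim_mem (hR'.mono Set.subset_union_left) fun p =>
        Or.inr (Set.mem_biUnion p.1.2 (Set.mem_range_self p.2))
    intro hmem
    rw [← hsplit] at hmem ⊢
    refine ha' k _ (hU _ _ _ ih _ hR' ?_) (hdef a')
    by_contra hn
    exact ha k _ (Ultrafilter.compl_mem_iff_notMem.2 hn) (hdef a).compl hmem

theorem definable_setOf_mem_iff {α : Type*} {B : Set Mbar} {Z : Set (α → Mbar)}
    (hZ : B.Definable L Z) (p : Prop) : B.Definable L {x | x ∈ Z ↔ p} := by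
  by_cases hp : p
  · simp only [hp, iff_true]
    exact hZ
  · simp only [hp, iff_false]
    exact hZ.compl

theorem definable_setOf_exists_pattern {B : Set Mbar} {l m : ℕ} {R : Set (Fin l ⊕ Fin n → Mbar)}
    (hR : B.Definable L R) (I : Set ℕ) : B.Definable L {z : Fin m × Fin n → Mbar |
      ∃ y, ∀ j : Fin m, Sum.elim y (fun i => z (j, i)) ∈ R ↔ (j : ℕ) ∈ I} := by
  let s : Fin m → Fin l ⊕ Fin n → (Fin m × Fin n) ⊕ Fin l := fun j =>
    Sum.elim Sum.inr fun i => Sum.inl (j, i)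
  have hdef : B.Definable L (⋂ j : Fin m, {c | c ∘ s j ∈ R ↔ (j : ℕ) ∈ I}) :=
    Set.definable_iInter_of_finite fun j => definable_setOf_mem_iff (hR.preimage_comp (s j)) _
  convert hdef.image_comp (Sum.inl : Fin m × Fin n → (Fin m × Fin n) ⊕ Fin l) using 1
  ext z
  have hs : ∀ y j, Sum.elim z y ∘ s j = Sum.elim y fun i => z (j, i) := fun y j => by
    ext (i | i) <;> rfl
  constructor
  · rintro ⟨y, hy⟩
    exact ⟨Sum.elim z y, Set.mem_iInter.2 fun j => by rw [Set.mem_ofPred_eq, hs]; exact hy j,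
      Sum.elim_comp_inl _ _⟩
  · rintro ⟨c, hc, rfl⟩
    refine ⟨c ∘ Sum.inr, fun j => ?_⟩
    have := Set.mem_iInter.1 hc j
    rw [← Sum.elim_comp_inl_inr c] at this
    rwa [← hs]

theorem IsSaturated.exists_forall_sumElim_mem_iff [Nonempty Mbar] (hsat : IsSaturated L κ Mbar)
    (hκ : ℵ₀ < κ) {l : ℕ} {R : Set (Fin l ⊕ Fin n → Mbar)}
    (hR : (∅ : Set Mbar).Definable L R) (a : ℕ → Fin n → Mbar) (I : Set ℕ)
    (hfin : ∀ m, ∃ y, ∀ j < m, Sum.elim y (a j) ∈ R ↔ j ∈ I) :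
    ∃ y, ∀ j, Sum.elim y (a j) ∈ R ↔ j ∈ I := by
  let Z : ℕ → Set (Fin l → Mbar) := fun m => {y | ∀ j < m, Sum.elim y (a j) ∈ R ↔ j ∈ I}
  have hZ : Antitone Z := fun m m' h y hy j hj => hy j (hj.trans_le h)
  have : (⨅ m, Filter.principal (Z m)).NeBot :=
    Filter.iInf_neBot_of_directed
      (Filter.monotone_principal.comp_antitone hZ).directed_ge
      fun m => Filter.principal_neBot_iff.2 (hfin m)
  have hcard : #(⋃ i, Set.range (a i) : Set Mbar) < κ :=
    (Set.countable_iUnion fun i => Set.countable_range (a i)).le_aleph0.trans_lt hκ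
  obtain ⟨y, hy⟩ := hsat.exists_mem_of_neBot hκ.le hcard (⨅ m, Filter.principal (Z m))
  refine ⟨y, fun j => hy (Z (j + 1)) (Filter.mem_iInf_of_mem _ (Filter.mem_principal_self _)) ?_ j
    j.lt_succ_self⟩
  have hmem : ∀ y i, Sum.elim y (a i) ∈ R ↔ Sum.elim (a i) y ∈ {c | c ∘ Sum.swap ∈ R} :=
    fun y i => iff_of_eq (congrArg (· ∈ R) Sum.elim_swap.symm)
  have hdef : ∀ i, (⋃ i, Set.range (a i)).Definable L {y | Sum.elim y (a i) ∈ R} := fun i => by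
    simp only [hmem]
    exact definable_setOf_sumElim_mem ((hR.preimage_comp _).mono (Set.empty_subset _))
      fun k => Set.mem_iUnion.2 ⟨i, k, rfl⟩
  have hZeq : Z (j + 1) = ⋂ i ∈ Finset.range (j + 1), {y | Sum.elim y (a i) ∈ R ↔ i ∈ I} := by
    ext; simp [Z]
  rw [hZeq]
  exact Set.definable_biInter_finset (fun i => definable_setOf_mem_iff (hdef i) _) _

theorem IsNIP.exists_unrealized_pattern {T : L.Theory} (hNIP : IsNIP.{u, v, w} T) [Nonempty Mbar]
    (hMbar : Mbar ⊨ T) (hsat : IsSaturated L κ Mbar) (hκ : ℵ₀ < κ) {l : ℕ}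
    {R : Set (Fin l ⊕ Fin n → Mbar)} (hR : (∅ : Set Mbar).Definable L R)
    (a : ℕ → Fin n → Mbar) :
    ∃ (I : Set ℕ) (m : ℕ), ∀ y, ¬ ∀ j < m, Sum.elim y (a j) ∈ R ↔ j ∈ I := by
  by_contra! h
  choose b hb using fun I => hsat.exists_forall_sumElim_mem_iff hκ hR a I (h I)
  obtain ⟨φ, rfl⟩ := Set.empty_definable_iff.1 hR
  refine hNIP n l (φ.relabel Sum.swap) (Theory.ModelType.of T Mbar) ⟨a, b, fun i I => ?_⟩
  exact Formula.realize_relabel.trans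
    ((iff_of_eq (congrArg φ.Realize Sum.elim_swap)).trans (hb I i))

theorem IsNIP.not_forall_exists_isMorleySeq {T : L.Theory} (hNIP : IsNIP.{u, v, w} T)
    [Nonempty Mbar] (hMbar : Mbar ⊨ T) (hsat : IsSaturated L κ Mbar) (hκ : ℵ₀ < κ)
    {U : Ultrafilter (Fin n → Mbar)} (hU : InvariantOver M U) {B : Set Mbar}
    {Y : Set (Fin n → Mbar)} (hY : B.Definable L Y) :
    ¬ ∀ I : Set ℕ, ∃ a, IsMorleySeq L M U a ∧ ∀ i, a i ∈ Y ↔ i ∈ I := by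
  intro h
  obtain ⟨l, b, -, R, hR, rfl⟩ := exists_eq_setOf_sumElim_mem hY
  obtain ⟨a, ha, -⟩ := h ∅
  obtain ⟨I, m, hIm⟩ := hNIP.exists_unrealized_pattern hMbar hsat hκ hR a
  obtain ⟨a', ha', hI⟩ := h I
  obtain ⟨y, hy⟩ := ha'.mem_of_mem ha hU (k := m) _
    (definable_setOf_exists_pattern (hR.mono (Set.empty_subset _)) I) ⟨b, fun j => hI j⟩
  exact hIm y fun j hj => hy ⟨j, hj⟩

end Morley

section SimonFilter

variable {L : FirstOrder.Language.{u, v}} {Mbar : Type w} [L.Structure Mbar] {n : ℕ}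
  {κ : Cardinal.{w}} {M : L.ElementarySubstructure Mbar}

variable (L) in
/-- The filter generated by the members of `F` definable with parameters in `B`; for an ultrafilter
`F` this is the restriction to `B` of the type defined by `F`. -/
def definableFilter {α : Type*} (B : Set Mbar) (F : Filter (α → Mbar)) : Filter (α → Mbar) where
  sets := {Z | ∃ X ∈ F, B.Definable L X ∧ X ⊆ Z}
  univ_sets := ⟨_, Filter.univ_mem, Set.definable_univ, subset_rfl⟩
  sets_of_superset := fun ⟨X, hX, hdef, hXZ⟩ hZ => ⟨X, hX, hdef, hXZ.trans hZ⟩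
  inter_sets := fun ⟨_, hX, hXdef, hXZ⟩ ⟨_, hX', hXdef', hXZ'⟩ =>
    ⟨_, Filter.inter_mem hX hX', hXdef.inter hXdef', Set.inter_subset_inter hXZ hXZ'⟩

/-- The partial type `F|_N(x) ∪ {P(x)}` of Simon's construction, as a filter. -/
def SimonPair.filter (D : SimonPair M) (F : Filter (Fin n → Mbar)) : Filter (Fin n → Mbar) :=
  definableFilter L D.N F ⊓ Filter.principal (tuples D.N (Fin n))

/-- The partial type `U|_N(x) ∪ {P(x)}` determines a complete type over `M'`. -/
def SimonPair.Decides (D : SimonPair M) (U : Ultrafilter (Fin n → Mbar)) : Prop :=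
  ∀ Y : Set (Fin n → Mbar), (D.M' : Set Mbar).Definable L Y →
    (∀ᶠ x in D.filter U, x ∈ Y) ∨ ∀ᶠ x in D.filter U, x ∉ Y

namespace SimonPair

variable {D : SimonPair M} {F : Filter (Fin n → Mbar)} {Y : Set (Fin n → Mbar)}

theorem mem_filter_iff :
    Y ∈ D.filter F ↔ ∃ X ∈ F, D.N.Definable L X ∧ X ∩ tuples D.N (Fin n) ⊆ Y := by
  refine Filter.mem_inf_principal.trans (exists_congr fun X => and_congr_right fun _ =>
    and_congr_right fun _ => ?_)
  exact ⟨fun h x hx => h hx.1 hx.2, fun h x hx hxN => h ⟨hx, hxN⟩⟩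

theorem mem_filter_of_definable {X : Set (Fin n → Mbar)} (hX : X ∈ F)
    (hdef : D.N.Definable L X) : X ∈ D.filter F :=
  mem_filter_iff.2 ⟨X, hX, hdef, Set.inter_subset_left⟩

theorem tuples_mem_filter : tuples D.N (Fin n) ∈ D.filter F :=
  Filter.mem_inf_of_right (Filter.mem_principal_self _)

instance neBot_filter [F.NeBot] : (D.filter F).NeBot := by
  refine Filter.neBot_iff.2 fun h => ?_
  obtain ⟨X, hX, hdef, hsub⟩ := mem_filter_iff.1 (Filter.empty_mem_iff_bot.2 h)
  exact (D.tuples_inter_nonempty hdef (Filter.nonempty_of_mem hX)).not_subset_empty hsub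

theorem exists_mem_tuples_of_frequently [Nonempty Mbar] (hM' : ℵ₀ ≤ #D.M') {A : Set Mbar}
    (hA : A ⊆ D.N) (hcard : #A ≤ #D.M') (hY : (D.M' : Set Mbar).Definable L Y)
    (h : ∃ᶠ x in D.filter F, x ∈ Y) :
    ∃ x ∈ tuples D.N (Fin n), x ∈ Y ∧ ∀ X ∈ F, A.Definable L X → x ∈ X := by
  obtain ⟨B, hB, hYB⟩ := Set.definable_iff_finitely_definable.1 hY
  have := Filter.frequently_mem_iff_neBot.1 h
  obtain ⟨x, hxN, hx⟩ := D.exists_mem_tuples_of_neBot hM' (B := A ∪ B)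
    (Set.union_subset (hA.trans D.N_sub) (hB.trans D.M'_subset_N'))
    ((Cardinal.mk_union_le _ _).trans (Cardinal.add_le_of_le hM' hcard
      ((Cardinal.lt_aleph0_of_finite B).le.trans hM')))
    (D.filter F ⊓ Filter.principal Y) (Filter.mem_inf_of_left tuples_mem_filter)
  exact ⟨x, hxN,
    hx Y (Filter.mem_inf_of_right (Filter.mem_principal_self Y))
      (hYB.mono Set.subset_union_right),
    fun X hX hdef => hx X (Filter.mem_inf_of_left (mem_filter_of_definable hX (hdef.mono hA)))
      (hdef.mono Set.subset_union_left)⟩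

/-- At each step one records both a realization in `Y` and one outside `Y`, so that every pattern
`I` is met by choosing among them. -/
theorem exists_isMorleySeq_of_frequently [Nonempty Mbar] (hM' : ℵ₀ ≤ #D.M')
    (hY : (D.M' : Set Mbar).Definable L Y) {U : Ultrafilter (Fin n → Mbar)}
    (h : ∃ᶠ x in D.filter U, x ∈ Y) (h' : ∃ᶠ x in D.filter U, x ∉ Y) (I : Set ℕ) :
    ∃ a, IsMorleySeq L M U a ∧ ∀ i, a i ∈ Y ↔ i ∈ I := by
  have hstep (A : Set Mbar) (hA : A ⊆ D.N) (hcard : #A ≤ #D.M') (p : Prop) :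
      ∃ x : tuples D.N (Fin n), (x.1 ∈ Y ↔ p) ∧ ∀ X ∈ U, A.Definable L X → x.1 ∈ X := by
    by_cases hp : p
    · obtain ⟨x, hxN, hxY, hx⟩ := exists_mem_tuples_of_frequently hM' hA hcard hY h
      exact ⟨⟨x, hxN⟩, iff_of_true hxY hp, hx⟩
    · obtain ⟨x, hxN, hxY, hx⟩ := exists_mem_tuples_of_frequently hM' hA hcard hY.compl h'
      exact ⟨⟨x, hxN⟩, iff_of_false hxY hp, hx⟩
  let previous (t : Set (Prop → tuples D.N (Fin n))) : Set Mbar :=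
    ⋃ c ∈ t, ⋃ p, Set.range (c p).1
  obtain ⟨c, hc⟩ := Set.seq_of_forall_finite_exists
    (P := fun (c : Prop → tuples D.N (Fin n)) t => ∀ p, ((c p).1 ∈ Y ↔ p) ∧
      ∀ X ∈ U, ((M : Set Mbar) ∪ previous t).Definable L X → (c p).1 ∈ X) fun t ht => by
    refine Classical.skolem.1 (hstep _ (Set.union_subset D.subset_N ?_) ?_)
    · refine Set.iUnion₂_subset fun c _ => Set.iUnion_subset fun p => ?_
      exact Set.range_subset_iff.2 (c p).2
    · have hfin : (previous t).Finite :=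
        ht.biUnion fun c _ => Set.finite_iUnion fun p => Set.finite_range _
      exact (Cardinal.mk_union_le _ _).trans (Cardinal.add_le_of_le hM'
        (Cardinal.mk_le_mk_of_subset D.M_le) (hfin.countable.le_aleph0.trans hM'))
  refine ⟨fun i => (c i (i ∈ I)).1, fun i X hX hdef => (hc i _).2 X hX (hdef.mono ?_),
    fun i => (hc i _).1⟩
  refine Set.union_subset_union_right _ (Set.iUnion₂_subset fun j hj => ?_)
  exact (Set.subset_iUnion (fun p => Set.range (c j p).1) _).trans
    (Set.subset_biUnion_of_mem (u := fun c => ⋃ p, Set.range (c p).1)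
      (Set.mem_image_of_mem c (Set.mem_Iio.2 hj)))

theorem decides_of_subset (h : (D.M' : Set Mbar) ⊆ D.N) (U : Ultrafilter (Fin n → Mbar)) :
    D.Decides U := fun Y hY =>
  (U.mem_or_compl_mem Y).imp (mem_filter_of_definable · (hY.mono h))
    (mem_filter_of_definable · (hY.mono h).compl)

end SimonPair

theorem coe_eq_univ_of_finite [Finite Mbar] (M : L.ElementarySubstructure Mbar) :
    (M : Set Mbar) = Set.univ := by
  have hcard : (Nat.card Mbar : Cardinal) ≤ #M := (Sentence.realize_cardGe L _).1
    ((M.realize_sentence _).2 ((Sentence.realize_cardGe L _).2 Nat.cast_card.le))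
  rw [← Nat.cast_card (α := M), Nat.cast_le] at hcard
  exact Set.eq_of_subset_of_ncard_le (Set.subset_univ _) (by rwa [Set.ncard_univ])

theorem InvariantOver.decides {T : L.Theory} (hNIP : IsNIP.{u, v, w} T) [Nonempty Mbar]
    (hMbar : Mbar ⊨ T) (hsat : IsSaturated L κ Mbar) (hκ : ℵ₀ < κ)
    {U : Ultrafilter (Fin n → Mbar)} (hU : InvariantOver M U) (D : SimonPair M) :
    D.Decides U := by
  cases finite_or_infinite Mbar
  · exact SimonPair.decides_of_subset
      ((Set.subset_univ _).trans ((coe_eq_univ_of_finite M).symm.subset.trans D.subset_N)) U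
  intro Y hY
  by_contra! h
  have : Infinite D.M' := D.M'.elementarilyEquivalent.infinite_iff.2 ‹_›
  refine hNIP.not_forall_exists_isMorleySeq hMbar hsat hκ hU hY
    (SimonPair.exists_isMorleySeq_of_frequently (Cardinal.aleph0_le_mk _) hY h.2 h.1)

end SimonFilter

section HonestSets

variable {L : FirstOrder.Language.{u, v}} {Mbar : Type w} [L.Structure Mbar] {n : ℕ}
  {M : L.ElementarySubstructure Mbar} {D : SimonPair M} {Y : Set (Fin n → Mbar)}
  {U : Ultrafilter (Fin n → Mbar)}

/-- Honesty over `M` of the formula defining `Θ`, in terms of definable sets. -/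
def IsHonestSet (M : L.ElementarySubstructure Mbar) (Θ : Set (Fin n → Mbar)) : Prop :=
  ∀ Z : Set (Fin n → Mbar), (M : Set Mbar).Definable L Z →
    Θ ∩ tuples (M : Set Mbar) (Fin n) ⊆ Z → Θ ⊆ Z

theorem isHonestSet_of_definable (hY : (M : Set Mbar).Definable L Y) : IsHonestSet M Y := by
  intro Z hZ hsub x hx
  by_contra hxZ
  obtain ⟨y, ⟨hy, hyZ⟩, hyM⟩ :=
    inter_tuples_nonempty_of_definable M (hY.inter hZ.compl) ⟨x, hx, hxZ⟩
  exact hyZ (hsub ⟨hy, hyM⟩)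

/-- `U` contains an honest definable set with the same trace on `M` as `Y`; this is the criterion
for `Y` to belong to the retract of the type defined by `U`. -/
def HonestTrace (M : L.ElementarySubstructure Mbar) (U : Ultrafilter (Fin n → Mbar))
    (Y : Set (Fin n → Mbar)) : Prop :=
  ∃ Θ ∈ U, (Set.univ : Set Mbar).Definable L Θ ∧ IsHonestSet M Θ ∧
    Θ ∩ tuples (M : Set Mbar) (Fin n) = Y ∩ tuples (M : Set Mbar) (Fin n)

namespace SimonPair

theorem isHonestSet (hY : (D.M' : Set Mbar).Definable L Y) {Θ : Set (Fin n → Mbar)}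
    (hΘ : D.N.Definable L Θ) (hΘY : Θ ∩ tuples D.N (Fin n) ⊆ Y)
    (hYΘ : Y ∩ tuples (M : Set Mbar) (Fin n) ⊆ Θ) : IsHonestSet M Θ := by
  intro Z hZ hsub x hx
  by_contra hxZ
  obtain ⟨y, ⟨hyΘ, hyZ⟩, hyN⟩ := D.tuples_inter_nonempty
    (hΘ.inter (hZ.compl.mono D.subset_N)) ⟨x, hx, hxZ⟩
  obtain ⟨z, ⟨hzY, hzZ⟩, hzM⟩ := D.inter_tuples_nonempty (hY.inter (hZ.compl.mono D.M_le))
    ⟨y, ⟨hΘY ⟨hyΘ, hyN⟩, hyZ⟩, hyN⟩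
  exact hzZ (hsub ⟨hYΘ ⟨hzY, hzM⟩, hzM⟩)

/-- If there were no such `Θ`, some ultrafilter on `Y ∩ Mⁿ` would avoid all sets definable over `N`
whose `N`-points lie in `Y`; being finitely satisfiable in `M` it is invariant, so it decides `Y`,
and it can do so in neither way. -/
theorem exists_honest_definition
    (hdec : ∀ V : Ultrafilter (Fin n → Mbar), InvariantOver M V → D.Decides V)
    (hY : (D.M' : Set Mbar).Definable L Y) :
    ∃ Θ, D.N.Definable L Θ ∧ Θ ∩ tuples D.N (Fin n) ⊆ Y ∧
      Y ∩ tuples (M : Set Mbar) (Fin n) ⊆ Θ := by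
  let small (S : Set (Fin n → Mbar)) : Prop := ∃ Θ, D.N.Definable L Θ ∧
    Θ ∩ tuples D.N (Fin n) ⊆ Y ∧ Y ∩ tuples (M : Set Mbar) (Fin n) ∩ S ⊆ Θ
  let G : Filter (Fin n → Mbar) := Filter.comk small
    ⟨∅, Set.definable_empty, by simp, by simp⟩
    (fun _ ⟨Θ, hΘ, hΘY, hYΘ⟩ _ hsub =>
      ⟨Θ, hΘ, hΘY, (Set.inter_subset_inter_right _ hsub).trans hYΘ⟩)
    (fun _ ⟨Θ, hΘ, hΘY, hYΘ⟩ _ ⟨Θ', hΘ', hΘY', hYΘ'⟩ => ⟨Θ ∪ Θ', hΘ.union hΘ',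
      Set.union_inter_distrib_right Θ Θ' _ ▸ Set.union_subset hΘY hΘY',
      Set.inter_union_distrib_left _ _ _ ▸ Set.union_subset_union hYΘ hYΘ'⟩)
  have hmem (S : Set (Fin n → Mbar)) (hS : small S) : Sᶜ ∈ G :=
    Filter.mem_comk.2 ((compl_compl S).symm ▸ hS)
  rcases G.eq_or_neBot with hbot | hne
  · have : small ∅ᶜ := Filter.mem_comk.1 (hbot ▸ Filter.mem_bot)
    simpa only [small, Set.compl_empty, Set.inter_univ] using this
  let V := Ultrafilter.of G
  have hVY : Y ∩ tuples (M : Set Mbar) (Fin n) ∈ V :=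
    Ultrafilter.of_le G (compl_compl (Y ∩ tuples (M : Set Mbar) (Fin n)) ▸
      hmem _ ⟨∅, Set.definable_empty, by simp, by simp⟩)
  have hV : InvariantOver M V :=
    invariantOver_of_tuples_mem (Filter.mem_of_superset hVY Set.inter_subset_right)
  exfalso
  rcases hdec V hV Y hY with h | h
  · obtain ⟨X, hX, hdef, hXY⟩ := mem_filter_iff.1 h
    exact Ultrafilter.compl_mem_iff_notMem.1
      (Ultrafilter.of_le G (hmem X ⟨X, hdef, hXY, Set.inter_subset_right⟩)) hX
  · obtain ⟨X, hX, -, hXY⟩ := mem_filter_iff.1 h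
    obtain ⟨x, hx, hxY, hxM⟩ := V.nonempty_of_mem (Filter.inter_mem hX hVY)
    exact hXY ⟨hx, fun i => D.subset_N (hxM i)⟩ hxY

theorem honestTrace_of_mem_filter
    (hdec : ∀ V : Ultrafilter (Fin n → Mbar), InvariantOver M V → D.Decides V)
    (hY : (D.M' : Set Mbar).Definable L Y) (h : Y ∈ D.filter U) : HonestTrace M U Y := by
  obtain ⟨X, hX, hXdef, hXY⟩ := mem_filter_iff.1 h
  obtain ⟨Θ, hΘ, hΘY, hYΘ⟩ := exists_honest_definition hdec hY
  have hsub : (X ∪ Θ) ∩ tuples D.N (Fin n) ⊆ Y :=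
    Set.union_inter_distrib_right X Θ _ ▸ Set.union_subset hXY hΘY
  have hsup : Y ∩ tuples (M : Set Mbar) (Fin n) ⊆ X ∪ Θ := hYΘ.trans Set.subset_union_right
  refine ⟨X ∪ Θ, Filter.mem_of_superset hX Set.subset_union_left,
    (hXdef.union hΘ).mono (Set.subset_univ _), isHonestSet hY (hXdef.union hΘ) hsub hsup, ?_⟩
  ext x
  exact ⟨fun hx => ⟨hsub ⟨hx.1, fun i => D.subset_N (hx.2 i)⟩, hx.2⟩, fun hx => ⟨hsup hx, hx.2⟩⟩

theorem mem_filter_of_isHonestSet (hdec : D.Decides U) (hY : (D.M' : Set Mbar).Definable L Y)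
    (hhon : IsHonestSet M Y) (hYU : Y ∈ U) : Y ∈ D.filter U := by
  refine (hdec Y hY).resolve_right fun h => ?_
  obtain ⟨X, hX, hdef, hXY⟩ := mem_filter_iff.1 h
  obtain ⟨l, b, hb, R, hR, rfl⟩ := exists_eq_setOf_sumElim_mem hdef
  have hR (B : Set Mbar) : B.Definable L R := hR.mono (Set.empty_subset B)
  have htransfer : ∀ c ∈ tuples (M : Set Mbar) (Fin l),
      (∃ x, Sum.elim c x ∈ {z | z ∈ R ∧ z ∘ Sum.inr ∈ Y}) →
      ∃ x ∈ tuples (M : Set Mbar) (Fin n), Sum.elim c x ∈ {z | z ∈ R ∧ z ∘ Sum.inr ∈ Y} := by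
    rintro c hc ⟨x, hxR, hxY⟩
    by_contra! hn
    exact hhon _ (definable_setOf_sumElim_mem (hR _) hc).compl
      (fun y hy hyR => hn y hy.2 ⟨hyR, hy.1⟩) hxY hxR
  obtain ⟨x, hxN, hxX, hxY⟩ := D.transfer_exists_sumElim_mem
    ((hR _).inter (hY.preimage_comp Sum.inr)) htransfer b hb
    (U.nonempty_of_mem (Filter.inter_mem hX hYU))
  exact hXY ⟨hxX, hxN⟩ hxY

theorem inter_tuples_nonempty_of_mem_filter (hY : (D.M' : Set Mbar).Definable L Y)
    (h : Y ∈ D.filter U) : (Y ∩ tuples (M : Set Mbar) (Fin n)).Nonempty :=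
  D.inter_tuples_nonempty hY (Filter.nonempty_of_mem (Filter.inter_mem h tuples_mem_filter))

end SimonPair

section HonestTrace

theorem exists_simonPair_definable {Z : Set (Fin n → Mbar)}
    (hD : ∀ s : Finset Mbar, ∃ D : SimonPair M, (s : Set Mbar) ⊆ D.M')
    (hY : (Set.univ : Set Mbar).Definable L Y) (hZ : (Set.univ : Set Mbar).Definable L Z) :
    ∃ D : SimonPair M, (D.M' : Set Mbar).Definable L Y ∧ (D.M' : Set Mbar).Definable L Z := by
  classical
  obtain ⟨B, -, hB⟩ := Set.definable_iff_finitely_definable.1 hY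
  obtain ⟨C, -, hC⟩ := Set.definable_iff_finitely_definable.1 hZ
  obtain ⟨D, h⟩ := hD (B ∪ C)
  rw [Finset.coe_union, Set.union_subset_iff] at h
  exact ⟨D, hB.mono h.1, hC.mono h.2⟩

variable (hdec : ∀ (D : SimonPair M) (V : Ultrafilter (Fin n → Mbar)),
    InvariantOver M V → D.Decides V)
  (hD : ∀ s : Finset Mbar, ∃ D : SimonPair M, (s : Set Mbar) ⊆ D.M') (hU : InvariantOver M U)

include hdec hD hU

theorem IsHonestSet.inter_tuples_nonempty {Θ Θ' : Set (Fin n → Mbar)}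
    (h : IsHonestSet M Θ) (h' : IsHonestSet M Θ') (hΘ : Θ ∈ U) (hΘ' : Θ' ∈ U)
    (hdef : (Set.univ : Set Mbar).Definable L Θ) (hdef' : (Set.univ : Set Mbar).Definable L Θ') :
    (Θ ∩ Θ' ∩ tuples (M : Set Mbar) (Fin n)).Nonempty := by
  obtain ⟨D, hDΘ, hDΘ'⟩ := exists_simonPair_definable hD hdef hdef'
  exact SimonPair.inter_tuples_nonempty_of_mem_filter (hDΘ.inter hDΘ')
    (Filter.inter_mem (SimonPair.mem_filter_of_isHonestSet (hdec D U hU) hDΘ h hΘ)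
      (SimonPair.mem_filter_of_isHonestSet (hdec D U hU) hDΘ' h' hΘ'))

theorem honestTrace_iff_mem_filter
    (hY : (D.M' : Set Mbar).Definable L Y) : HonestTrace M U Y ↔ Y ∈ D.filter U := by
  refine ⟨fun ⟨Θ, hΘ, hdef, hhon, htr⟩ => ?_, D.honestTrace_of_mem_filter (hdec D) hY⟩
  refine (hdec D U hU Y hY).resolve_right fun h => ?_
  obtain ⟨Θ', hΘ', hdef', hhon', htr'⟩ := D.honestTrace_of_mem_filter (hdec D) hY.compl h
  obtain ⟨x, ⟨hxΘ, hxΘ'⟩, hxM⟩ :=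
    hhon.inter_tuples_nonempty hdec hD hU hhon' hΘ hΘ' hdef hdef'
  exact (htr'.subset ⟨hxΘ', hxM⟩).1 (htr.subset ⟨hxΘ, hxM⟩).1

theorem HonestTrace.inter {Z : Set (Fin n → Mbar)}
    (hYtr : HonestTrace M U Y) (hZtr : HonestTrace M U Z)
    (hY : (Set.univ : Set Mbar).Definable L Y) (hZ : (Set.univ : Set Mbar).Definable L Z) :
    HonestTrace M U (Y ∩ Z) := by
  obtain ⟨D, hDY, hDZ⟩ := exists_simonPair_definable hD hY hZ
  rw [honestTrace_iff_mem_filter hdec hD hU hDY] at hYtr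
  rw [honestTrace_iff_mem_filter hdec hD hU hDZ] at hZtr
  exact (honestTrace_iff_mem_filter hdec hD hU (hDY.inter hDZ)).2 (Filter.inter_mem hYtr hZtr)

theorem honestTrace_or_honestTrace_compl
    (hY : (Set.univ : Set Mbar).Definable L Y) : HonestTrace M U Y ∨ HonestTrace M U Yᶜ := by
  obtain ⟨D, hDY, -⟩ := exists_simonPair_definable hD hY hY
  exact (hdec D U hU Y hDY).imp (D.honestTrace_of_mem_filter (hdec D) hDY)
    (D.honestTrace_of_mem_filter (hdec D) hDY.compl)

theorem exists_ultrafilter_mem_iff_honestTrace :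
    ∃ V : Ultrafilter (Fin n → Mbar), tuples (M : Set Mbar) (Fin n) ∈ V ∧
      ∀ Y, (Set.univ : Set Mbar).Definable L Y → (Y ∈ V ↔ HonestTrace M U Y) := by
  let G : Filter (Fin n → Mbar) :=
    { sets := {Z | ∃ Y, (Set.univ : Set Mbar).Definable L Y ∧ HonestTrace M U Y ∧
        Y ∩ tuples (M : Set Mbar) (Fin n) ⊆ Z}
      univ_sets := ⟨_, Set.definable_univ, ⟨_, Filter.univ_mem, Set.definable_univ,
        isHonestSet_of_definable Set.definable_univ, rfl⟩, Set.subset_univ _⟩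
      sets_of_superset := fun ⟨Y, hY, hYtr, hsub⟩ hZ => ⟨Y, hY, hYtr, hsub.trans hZ⟩
      inter_sets := fun ⟨Y, hY, hYtr, hsub⟩ ⟨Y', hY', hYtr', hsub'⟩ =>
        ⟨_, hY.inter hY', hYtr.inter hdec hD hU hYtr' hY hY',
          fun x hx => ⟨hsub ⟨hx.1.1, hx.2⟩, hsub' ⟨hx.1.2, hx.2⟩⟩⟩ }
  have hG (Y : Set (Fin n → Mbar)) (hY : (Set.univ : Set Mbar).Definable L Y)
      (hYtr : HonestTrace M U Y) : Y ∈ G := ⟨Y, hY, hYtr, Set.inter_subset_left⟩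
  have : G.NeBot := by
    refine Filter.neBot_iff.2 fun hbot => ?_
    obtain ⟨Y, -, ⟨Θ, hΘ, hdef, hhon, htr⟩, hsub⟩ := Filter.empty_mem_iff_bot.2 hbot
    obtain ⟨x, hx, hxM⟩ := hhon.inter_tuples_nonempty hdec hD hU hhon hΘ hΘ hdef hdef
    exact hsub (htr.subset ⟨hx.1, hxM⟩)
  refine ⟨Ultrafilter.of G, Ultrafilter.of_le G ⟨_, Set.definable_univ,
    ⟨_, Filter.univ_mem, Set.definable_univ, isHonestSet_of_definable Set.definable_univ, rfl⟩,
    Set.inter_subset_right⟩, fun Y hY => ⟨fun h => ?_, fun h => Ultrafilter.of_le G (hG Y hY h)⟩⟩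
  refine (honestTrace_or_honestTrace_compl hdec hD hU hY).resolve_right fun htr => ?_
  exact Ultrafilter.compl_mem_iff_notMem.1 (Ultrafilter.of_le G (hG _ hY.compl htr)) h

end HonestTrace

end HonestSets

section Parameters

variable {L : FirstOrder.Language.{u, v}} {Mbar : Type w} [L.Structure Mbar] {n : ℕ}
  {M : L.ElementarySubstructure Mbar}

theorem realize_onFormula_lhomWithConstantsMap {α γ : Type*} (f : α → Mbar)
    (ψ : L[[α]].Formula γ) (a : γ → Mbar) :
    ((L.lhomWithConstantsMap f).onFormula ψ).Realize a ↔
      Formula.Realize (BoundedFormula.constantsVarsEquiv ψ : L.Formula (α ⊕ γ))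
        (Sum.elim f a) := by
  let _ : (constantsOn α).Structure Mbar := constantsOn.structure f
  have : (LHom.constantsOnMap f).IsExpansionOn Mbar :=
    constantsOnMap_isExpansionOn (fα := f) (fβ := id) rfl
  have : (L.lhomWithConstantsMap f).IsExpansionOn Mbar :=
    LHom.sumMap_isExpansionOn (LHom.id L) (LHom.constantsOnMap f) Mbar
  rw [LHom.realize_onFormula]
  exact BoundedFormula.realize_constantsVarsEquiv.symm

theorem realize_withParams (A : Set Mbar) (φ : L[[A]].Formula (Fin n)) (a : Fin n → Mbar) :
    (withParams A φ).Realize a ↔ φ.Realize a :=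
  (realize_onFormula_lhomWithConstantsMap _ φ a).trans BoundedFormula.realize_constantsVarsEquiv

theorem realize_onFormula_equiv (σ : Mbar ≃[L] Mbar) (ψ : L[[Mbar]].Formula (Fin n))
    (a : Fin n → Mbar) :
    ((L.lhomWithConstantsMap σ).onFormula ψ).Realize a ↔ ψ.Realize (σ.symm ∘ a) := by
  have hσ : Sum.elim σ a = σ ∘ Sum.elim id (σ.symm ∘ a) := by
    ext (i | i)
    · rfl
    · exact (Language.Equiv.apply_symm_apply σ (a i)).symm
  rw [realize_onFormula_lhomWithConstantsMap, hσ, StrongHomClass.realize_formula]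
  exact BoundedFormula.realize_constantsVarsEquiv

/-- The set defined by a formula with parameters in `Mbar`. -/
def solutionSet (ψ : L[[Mbar]].Formula (Fin n)) : Set (Fin n → Mbar) := {a | ψ.Realize a}

theorem definable_solutionSet_withParams (A : Set Mbar) (φ : L[[A]].Formula (Fin n)) :
    A.Definable L (solutionSet (withParams A φ)) :=
  ⟨φ, Set.ext fun a => realize_withParams A φ a⟩

theorem exists_solutionSet_withParams_eq {A : Set Mbar} {Y : Set (Fin n → Mbar)}
    (hY : A.Definable L Y) : ∃ φ : L[[A]].Formula (Fin n), solutionSet (withParams A φ) = Y := by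
  obtain ⟨φ, rfl⟩ := hY
  exact ⟨φ, Set.ext fun a => realize_withParams A φ a⟩

theorem definable_solutionSet (ψ : L[[Mbar]].Formula (Fin n)) :
    (Set.univ : Set Mbar).Definable L (solutionSet ψ) := by
  convert definable_setOf_realize (b := (id : Mbar → Mbar)) (fun _ => Set.mem_univ _)
    (BoundedFormula.constantsVarsEquiv ψ : L.Formula (Mbar ⊕ Fin n)) using 1
  ext a
  exact BoundedFormula.realize_constantsVarsEquiv.symm

theorem trace_eq (ψ : L[[Mbar]].Formula (Fin n)) :
    trace M ψ = solutionSet ψ ∩ tuples (M : Set Mbar) (Fin n) := Set.inter_comm _ _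

theorem isHonest_iff (θ : L[[Mbar]].Formula (Fin n)) :
    IsHonest M θ ↔ IsHonestSet M (solutionSet θ) := by
  constructor
  · intro h Z hZ hsub
    obtain ⟨φ, rfl⟩ := exists_solutionSet_withParams_eq hZ
    exact fun a ha => h φ (fun x hx => ⟨hx.1, hsub ⟨hx.2, hx.1⟩⟩) a ha
  · intro h φ hsub a ha
    exact h _ (definable_solutionSet_withParams (M : Set Mbar) φ)
      (fun x hx => (hsub ⟨hx.2, hx.1⟩).2) ha

theorem isHonest_ofModel (φ : L[[M]].Formula (Fin n)) : IsHonest M (ofModel M φ) :=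
  (isHonest_iff _).2
    (isHonestSet_of_definable (definable_solutionSet_withParams (M : Set Mbar) φ))

end Parameters

section Automorphisms

variable {L : FirstOrder.Language.{u, v}} {Mbar : Type w} [L.Structure Mbar]
  {κ : Cardinal.{w}}

theorem comp_mem_iff_of_definable {α : Type*} {B : Set Mbar} {R : Set (α → Mbar)}
    (hR : B.Definable L R) (σ : Mbar ≃[L] Mbar) (hσ : ∀ b ∈ B, σ b = b) (x : α → Mbar) :
    σ ∘ x ∈ R ↔ x ∈ R := by
  obtain ⟨φ, rfl⟩ := Set.definable_iff_exists_formula_sum.1 hR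
  have hfix : Sum.elim (fun b : B => (b : Mbar)) (σ ∘ x) =
      σ ∘ Sum.elim (fun b : B => (b : Mbar)) x := by
    ext (b | i)
    · exact (hσ b b.2).symm
    · rfl
  rw [Set.mem_ofPred_eq, hfix]
  exact StrongHomClass.realize_formula σ φ

theorem IsStronglyHomogeneous.exists_equiv (hhom : IsStronglyHomogeneous L κ Mbar) {I : Type w}
    (hI : #I < κ) {x y : I → Mbar} (h : SameType L x y) : ∃ σ : Mbar ≃[L] Mbar, σ ∘ x = y := by
  choose i hi using fun b : Set.range x => b.2
  have hx : x ∘ i = Subtype.val := funext hi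
  obtain ⟨σ, hσ⟩ := hhom (Set.range x) (Cardinal.mk_range_le.trans_lt hI) (y ∘ i)
    (hx ▸ h.comp i)
  exact ⟨σ, funext fun j => (hσ ⟨x j, j, rfl⟩).trans ((h.eq_iff _ _).1 (hi ⟨x j, j, rfl⟩))⟩

theorem IsStronglyHomogeneous.exists_equiv_fixing (hhom : IsStronglyHomogeneous L κ Mbar)
    (hκ : ℵ₀ ≤ κ) {B : Set Mbar} (hB : #B < κ) {γ : Type} [Finite γ] {b b' : γ → Mbar}
    (h : ∀ Z : Set (γ → Mbar), B.Definable L Z → b ∈ Z → b' ∈ Z) :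
    ∃ σ : Mbar ≃[L] Mbar, (∀ m ∈ B, σ m = m) ∧ σ ∘ b = b' := by
  have hsame : SameType L (Sum.elim (fun m : B => (m : Mbar)) b)
      (Sum.elim (fun m : B => (m : Mbar)) b') :=
    SameType.of_realize_imp fun φ => h _ (definable_setOf_realize Subtype.prop φ)
  have hcard : #(B ⊕ ULift.{w} γ) < κ := by
    rw [Cardinal.mk_sum, Cardinal.lift_id, Cardinal.lift_id]
    exact Cardinal.add_lt_of_lt hκ hB ((Cardinal.lt_aleph0_of_finite _).trans_le hκ)
  obtain ⟨σ, hσ⟩ := hhom.exists_equiv hcard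
    (hsame.comp (Sum.map id ULift.down : B ⊕ ULift.{w} γ → B ⊕ γ))
  exact ⟨σ, fun m hm => congrFun hσ (Sum.inl ⟨m, hm⟩), funext fun i => congrFun hσ (Sum.inr ⟨i⟩)⟩

theorem IsMonster.isStronglyHomogeneous (h : IsMonster L κ Mbar) (hκ : ℵ₀ < κ) :
    IsStronglyHomogeneous L κ Mbar :=
  h.card_eq_or_homogeneous.elim (fun hc => h.saturated.isStronglyHomogeneous hκ hc) id

end Automorphisms

section CompleteTypes

variable {L : FirstOrder.Language.{u, v}} {Y : Type w} [L.Structure Y] {n : ℕ}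

theorem realize_iExs_relabel_inr {X : Type*} [L.Structure X] (ψ : L.Formula (Fin n)) :
    X ⊨ (ψ.relabel (Sum.inr : Fin n → Empty ⊕ Fin n)).iExs (Fin n) ↔
      ∃ x : Fin n → X, ψ.Realize x := by
  refine Formula.realize_iExs.trans (exists_congr fun x => ?_)
  rw [Formula.realize_relabel, Sum.elim_comp_inr]

theorem exists_realize_of_mem_completeType {p : (L.completeTheory Y).CompleteType (Fin n)}
    {ψ : L.Formula (Fin n)} (h : Formula.equivSentence ψ ∈ p) : ∃ a : Fin n → Y, ψ.Realize a := by
  obtain ⟨A, a, rfl⟩ := Theory.exists_modelType_is_realized_in _ p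
  rw [← realize_iExs_relabel_inr, ← realize_iff_of_model_completeTheory Y A,
    realize_iExs_relabel_inr]
  exact ⟨a, Theory.CompleteType.formula_mem_typeOf.1 h⟩

theorem exists_completeType_of_ultrafilter [Nonempty Y] (U : Ultrafilter (Fin n → Y)) :
    ∃ p : (L.completeTheory Y).CompleteType (Fin n), ∀ ψ : L.Formula (Fin n),
      Formula.equivSentence ψ ∈ p ↔ {a | ψ.Realize a} ∈ U := by
  have : Ultrapower U Y ⊨ L.completeTheory Y :=
    ((Ultrapower.diagonal U).theory_model_iff _).1 inferInstance
  exact ⟨(L.completeTheory Y).typeOf fun i => Ultrapower.mk U fun a => a i, fun ψ =>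
    Theory.CompleteType.formula_mem_typeOf.trans
      (Ultrapower.realize_mk U ψ fun (i : Fin n) (a : Fin n → Y) => a i)⟩

end CompleteTypes

section Types

variable {L : FirstOrder.Language.{u, v}} {Mbar : Type w} [L.Structure Mbar] [Nonempty Mbar]
  {n : ℕ} {M : L.ElementarySubstructure Mbar} {p : TypeSpace L Mbar n}
  {φ ψ : L[[Mbar]].Formula (Fin n)}

/-- The type `p` consists of the formulas defining sets in the ultrafilter `U`. -/
def IsTypeOf (U : Ultrafilter (Fin n → Mbar)) (p : TypeSpace L Mbar n) : Prop :=
  ∀ ψ : L[[Mbar]].Formula (Fin n), InType ψ p ↔ solutionSet ψ ∈ U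

theorem exists_isTypeOf_of_ultrafilter (U : Ultrafilter (Fin n → Mbar)) :
    ∃ p : TypeSpace L Mbar n, IsTypeOf U p :=
  exists_completeType_of_ultrafilter (L := L[[Mbar]]) U

theorem InType.nonempty_solutionSet (h : InType ψ p) : (solutionSet ψ).Nonempty :=
  exists_realize_of_mem_completeType (L := L[[Mbar]]) h

theorem inType_not : InType ψ.not p ↔ ¬ InType ψ p := by
  rw [InType, Formula.equivSentence_not, Theory.CompleteType.not_mem_iff, InType]

theorem inType_inf : InType (φ ⊓ ψ) p ↔ InType φ p ∧ InType ψ p := by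
  rw [InType, Formula.equivSentence_inf]
  exact Set.ext_iff.1 (Theory.CompleteType.typesWith_inf (T := L.elementaryDiagram Mbar)
    (Formula.equivSentence φ) (Formula.equivSentence ψ)) p

theorem inType_top : InType (⊤ : L[[Mbar]].Formula (Fin n)) p := by
  by_contra h
  obtain ⟨a, ha⟩ := (inType_not.2 h).nonempty_solutionSet
  exact ha (Formula.realize_top.2 trivial)

theorem typeSpace_eq_of_inType_imp {q : TypeSpace L Mbar n}
    (h : ∀ ψ : L[[Mbar]].Formula (Fin n), InType ψ p → InType ψ q) : p = q := by
  refine SetLike.ext fun φ => ?_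
  obtain ⟨ψ, rfl⟩ := Formula.equivSentence.surjective φ
  refine ⟨h ψ, fun hq => ?_⟩
  by_contra hp
  exact inType_not.1 (h _ (inType_not.2 hp)) hq

theorem exists_isTypeOf (p : TypeSpace L Mbar n) :
    ∃ U : Ultrafilter (Fin n → Mbar), IsTypeOf U p := by
  let G : Filter (Fin n → Mbar) :=
    { sets := {Z | ∃ ψ : L[[Mbar]].Formula (Fin n), InType ψ p ∧ solutionSet ψ ⊆ Z}
      univ_sets := ⟨⊤, inType_top, Set.subset_univ _⟩
      sets_of_superset := fun ⟨ψ, hψ, hsub⟩ hZ => ⟨ψ, hψ, hsub.trans hZ⟩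
      inter_sets := fun ⟨φ, hφ, hφZ⟩ ⟨ψ, hψ, hψZ⟩ => ⟨φ ⊓ ψ, inType_inf.2 ⟨hφ, hψ⟩, fun _ ha =>
        ⟨hφZ (Formula.realize_inf.1 ha).1, hψZ (Formula.realize_inf.1 ha).2⟩⟩ }
  have : G.NeBot := by
    refine Filter.neBot_iff.2 fun hbot => ?_
    obtain ⟨ψ, hψ, hsub⟩ := Filter.empty_mem_iff_bot.2 hbot
    exact hψ.nonempty_solutionSet.not_subset_empty hsub
  have hG (ψ : L[[Mbar]].Formula (Fin n)) (hψ : InType ψ p) : solutionSet ψ ∈ Ultrafilter.of G :=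
    Ultrafilter.of_le G ⟨ψ, hψ, subset_rfl⟩
  refine ⟨Ultrafilter.of G, fun ψ => ⟨hG ψ, fun h => ?_⟩⟩
  by_contra hn
  exact Ultrafilter.compl_mem_iff_notMem.1 (hG ψ.not (inType_not.2 hn)) h

theorem IsInvariant.invariantOver {κ : Cardinal.{w}} (hhom : IsStronglyHomogeneous L κ Mbar)
    (hκ : ℵ₀ ≤ κ) (hM : #M < κ) (hp : IsInvariant M p) {U : Ultrafilter (Fin n → Mbar)}
    (hU : IsTypeOf U p) : InvariantOver M U := by
  intro γ _ b b' hb R hR hbR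
  obtain ⟨σ, hσM, rfl⟩ := hhom.exists_equiv_fixing hκ hM hb
  have hRM := comp_mem_iff_of_definable hR σ hσM
  obtain ⟨ψ, hψ⟩ := exists_solutionSet_withParams_eq
    (definable_setOf_sumElim_mem (hR.mono (Set.subset_univ _)) fun i => Set.mem_univ (b i))
  have hσψ := (hp σ hσM).subset ⟨_, (hU _).2 (hψ ▸ hbR), rfl⟩
  refine Filter.mem_of_superset ((hU _).1 hσψ) fun a ha => ?_
  have hmem := hψ.subset ((realize_onFormula_equiv σ _ a).1 ha)
  rw [Set.mem_ofPred_eq, ← hRM, Sum.comp_elim, ← Function.comp_assoc] at hmem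
  rwa [show σ ∘ σ.symm = id from funext (Language.Equiv.apply_symm_apply σ)] at hmem

theorem honestTrace_solutionSet_iff {U : Ultrafilter (Fin n → Mbar)} (hp : IsTypeOf U p)
    (ψ : L[[Mbar]].Formula (Fin n)) : HonestTrace M U (solutionSet ψ) ↔
      ∃ θ : L[[Mbar]].Formula (Fin n), IsHonest M θ ∧ InType θ p ∧ trace M θ = trace M ψ := by
  constructor
  · rintro ⟨Θ, hΘ, hdef, hhon, htr⟩
    obtain ⟨θ, rfl⟩ := exists_solutionSet_withParams_eq hdef
    exact ⟨_, (isHonest_iff _).2 hhon, (hp _).2 hΘ, by rw [trace_eq, trace_eq, htr]⟩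
  · rintro ⟨θ, hθ, hpθ, htr⟩
    exact ⟨_, (hp θ).1 hpθ, definable_solutionSet θ, (isHonest_iff θ).1 hθ, by
      rw [← trace_eq, ← trace_eq, htr]⟩

theorem closure_singleton_eq {χ : L[[M]].Formula (Fin n)} (p : TypesOn M χ) :
    closure {p} = ⋂ θ ∈ {θ : L[[Mbar]].Formula (Fin n) | IsHonest M θ ∧ InType θ p.1},
      typesContaining M χ θ := by
  have hclosed (θ : L[[Mbar]].Formula (Fin n)) (hθ : IsHonest M θ) :
      IsClosed (typesContaining M χ θ) :=
    ⟨TopologicalSpace.isOpen_generateFrom_of_mem ⟨θ, hθ, rfl⟩⟩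
  refine Set.Subset.antisymm (closure_minimal
    (Set.singleton_subset_iff.2 (Set.mem_iInter₂.2 fun θ hθ => hθ.2))
    (isClosed_biInter fun θ hθ => hclosed θ hθ.1)) fun q hq => ?_
  rw [← specializes_iff_mem_closure, Specializes, TopologicalSpace.nhds_generateFrom (a := q)]
  refine le_iInf₂ fun s hs => ?_
  obtain ⟨hqs, θ, hθ, rfl⟩ := hs
  refine Filter.le_principal_iff.2 (IsOpen.mem_nhds (hclosed θ hθ).isOpen_compl fun hp => hqs ?_)
  exact Set.mem_iInter₂.1 hq θ ⟨hθ, hp⟩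

end Types

section Retract

variable {L : FirstOrder.Language.{u, v}} {Mbar : Type w} [L.Structure Mbar] [Nonempty Mbar]
  {n : ℕ} {M : L.ElementarySubstructure Mbar} {p q : TypeSpace L Mbar n}
  {U V : Ultrafilter (Fin n → Mbar)}

theorem consistentWithP_iff_frequently (hp : IsTypeOf U p) (hq : IsTypeOf V q) (D : SimonPair M) :
    ConsistentWithP D.N (restrictTo p D.N ∪ restrictTo q (D.M' : Set Mbar)) ↔
      ∀ Y ∈ V, (D.M' : Set Mbar).Definable L Y → ∃ᶠ x in D.filter U, x ∈ Y := by
  classical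
  constructor
  · intro h Y hY hdef hnot
    obtain ⟨X, hX, hXdef, hXY⟩ := SimonPair.mem_filter_iff.1 hnot
    obtain ⟨φ, rfl⟩ := exists_solutionSet_withParams_eq hXdef
    obtain ⟨ψ, rfl⟩ := exists_solutionSet_withParams_eq hdef
    obtain ⟨a, haN, ha⟩ := h {withParams D.N φ, withParams D.M' ψ} (by
      rw [Finset.coe_pair, Set.pair_subset_iff]
      exact ⟨Or.inl ⟨(hp _).2 hX, φ, rfl⟩, Or.inr ⟨(hq _).2 hY, ψ, rfl⟩⟩)
    simp only [Finset.forall_mem_insert, Finset.mem_singleton, forall_eq] at ha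
    exact hXY ⟨ha.1, haN⟩ ha.2
  · intro h Γ hΓ
    have : (D.filter U ⊓
        definableFilter L (D.M' : Set Mbar) (V : Filter (Fin n → Mbar))).NeBot := by
      rw [Filter.inf_neBot_iff_frequently_right]
      rintro P ⟨Y, hY, hdef, hsub⟩
      exact (h Y hY hdef).mono fun x hx => hsub hx
    have hmem : ∀ φ ∈ Γ, solutionSet φ ∈ D.filter U ⊓ definableFilter L (D.M' : Set Mbar) V := by
      intro φ hφ
      rcases hΓ hφ with ⟨hφp, φ₀, rfl⟩ | ⟨hφq, φ₀, rfl⟩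
      · exact Filter.mem_inf_of_left (SimonPair.mem_filter_of_definable ((hp _).1 hφp)
          (definable_solutionSet_withParams _ φ₀))
      · exact Filter.mem_inf_of_right ⟨_, (hq _).1 hφq,
          definable_solutionSet_withParams _ φ₀, subset_rfl⟩
    obtain ⟨a, haN, ha⟩ := Filter.nonempty_of_mem (Filter.inter_mem
      (Filter.mem_inf_of_left SimonPair.tuples_mem_filter) ((Filter.biInter_finset_mem Γ).2 hmem))
    exact ⟨a, haN, fun φ hφ => Set.mem_iInter₂.1 ha φ hφ⟩

theorem isSimonRetract_iff_eq
    (hdec : ∀ (D : SimonPair M) (V : Ultrafilter (Fin n → Mbar)),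
      InvariantOver M V → D.Decides V)
    (hD : ∀ s : Finset Mbar, ∃ D : SimonPair M, (s : Set Mbar) ⊆ D.M') (hU : InvariantOver M U)
    (hp : IsTypeOf U p) {F : TypeSpace L Mbar n} (hF : IsTypeOf V F)
    (hV : ∀ Y, (Set.univ : Set Mbar).Definable L Y → (Y ∈ V ↔ HonestTrace M U Y)) :
    IsSimonRetract M p q ↔ q = F := by
  constructor
  · intro hq
    obtain ⟨W, hW⟩ := exists_isTypeOf q
    refine typeSpace_eq_of_inType_imp fun ψ hψ => ?_
    obtain ⟨D, hdef, -⟩ :=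
      exists_simonPair_definable hD (definable_solutionSet ψ) (definable_solutionSet ψ)
    have hfreq := (consistentWithP_iff_frequently hp hW D).1 (hq D) _ ((hW ψ).1 hψ) hdef
    rw [hF, hV _ (definable_solutionSet ψ), honestTrace_iff_mem_filter hdec hD hU hdef]
    exact (hdec D U hU _ hdef).resolve_right hfreq
  · rintro rfl D
    refine (consistentWithP_iff_frequently hp hF D).2 fun Y hY hdef => ?_
    exact Filter.Eventually.frequently ((honestTrace_iff_mem_filter hdec hD hU hdef).1
      ((hV Y (hdef.mono (Set.subset_univ _))).1 hY))

end Retract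

section Cardinals

theorem exists_cardinal_of_two_power_lt {κ a : Cardinal.{w}} {c : Cardinal.{u}}
    (h : (2 : Cardinal.{max u w}) ^ ((2 : Cardinal.{max u w}) ^
        max ℵ₀ (max (Cardinal.lift.{u, w} a) (Cardinal.lift.{w, u} c))) <
      Cardinal.lift.{u, w} κ) :
    ∃ l : Cardinal.{w}, ℵ₀ ≤ l ∧ a ≤ l ∧
      Cardinal.lift.{w, u} c ≤ Cardinal.lift.{u, w} l ∧ 2 ^ (2 : Cardinal.{w}) ^ l < κ := by
  obtain ⟨l, hl⟩ := Cardinal.mem_range_lift_of_le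
    (((Cardinal.cantor _).trans (Cardinal.cantor _)).trans h).le
  rw [← hl, ← Cardinal.lift_two_power, ← Cardinal.lift_two_power, Cardinal.lift_lt] at h
  obtain ⟨hl₀, hla, hlc⟩ : ℵ₀ ≤ Cardinal.lift.{u, w} l ∧ _ ≤ _ ∧ _ ≤ _ := by
    simpa only [max_le_iff] using hl.ge
  exact ⟨l, Cardinal.aleph0_le_lift.1 hl₀, Cardinal.lift_le.1 hla, hlc, h⟩

end Cardinals

end Honest

theorem mainTheorem5 {L : FirstOrder.Language.{u, v}} (T : L.Theory) (hT : T.IsComplete)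
    (hNIP : Honest.IsNIP.{u, v, w} T)
    {Mbar : Type w} [L.Structure Mbar] [Nonempty Mbar] (hMbar : Mbar ⊨ T)
    (M : L.ElementarySubstructure Mbar)
    (κ : Cardinal.{w})
    (hκ : (2 : Cardinal.{max u v w}) ^ ((2 : Cardinal.{max u v w}) ^
        max ℵ₀ (max (Cardinal.lift.{max u v, w} #M) (Cardinal.lift.{w, max u v} L.card))) <
      Cardinal.lift.{max u v, w} κ)
    (hsat : Honest.IsMonster L κ Mbar)
    {n : ℕ} (χ : L[[M]].Formula (Fin n))
    (p : Honest.TypesOn M χ) (hp : Honest.IsInvariant M p.1) :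
    ∃ F : Honest.TypesOn M χ,
      (∀ q : Honest.TypeSpace L Mbar n, Honest.IsSimonRetract M p.1 q ↔ q = F.1) ∧
      Honest.IsFinSat M F.1 ∧
      (∀ ψ : L[[Mbar]].Formula (Fin n), Honest.InType ψ F.1 ↔
        ∃ θ : L[[Mbar]].Formula (Fin n), Honest.IsHonest M θ ∧ Honest.InType θ p.1 ∧
          Honest.trace M θ = Honest.trace M ψ) ∧
      F ∈ closure {p} ∧
      closure {p} =
        ⋂ θ ∈ {θ : L[[Mbar]].Formula (Fin n) | Honest.IsHonest M θ ∧ Honest.InType θ p.1},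
          Honest.typesContaining M χ θ := by
  obtain ⟨l, hl, hlM, hlL, hpow⟩ := Honest.exists_cardinal_of_two_power_lt hκ
  have hlκ : l < κ := ((Cardinal.cantor _).trans (Cardinal.cantor _)).trans hpow
  have hD := Honest.exists_simonPair hsat.saturated hl hlL hpow hlM
  obtain ⟨U, hU⟩ := Honest.exists_isTypeOf p.1
  have hinv : Honest.InvariantOver M U := hp.invariantOver
    (hsat.isStronglyHomogeneous (hl.trans_lt hlκ)) (hl.trans hlκ.le) (hlM.trans_lt hlκ) hU
  have hdec (D : Honest.SimonPair M) (V : Ultrafilter (Fin n → Mbar))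
      (hV : Honest.InvariantOver M V) : D.Decides V :=
    hV.decides hNIP hMbar hsat.saturated (hl.trans_lt hlκ) D
  obtain ⟨V, hVM, hV⟩ := Honest.exists_ultrafilter_mem_iff_honestTrace hdec hD hinv
  obtain ⟨F, hF⟩ := Honest.exists_isTypeOf_of_ultrafilter (L := L) V
  have hmem (ψ : L[[Mbar]].Formula (Fin n)) : Honest.InType ψ F ↔
      ∃ θ, Honest.IsHonest M θ ∧ Honest.InType θ p.1 ∧ Honest.trace M θ = Honest.trace M ψ := by
    rw [hF, hV _ (Honest.definable_solutionSet ψ), Honest.honestTrace_solutionSet_iff hU]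
  have hhonest (θ : L[[Mbar]].Formula (Fin n)) (hθ : Honest.IsHonest M θ)
      (hθp : Honest.InType θ p.1) : Honest.InType θ F := (hmem θ).2 ⟨θ, hθ, hθp, rfl⟩
  have hχ : Honest.InType (Honest.ofModel M χ) F := hhonest _ (Honest.isHonest_ofModel χ) p.2
  refine ⟨⟨F, hχ⟩, fun q => Honest.isSimonRetract_iff_eq hdec hD hinv hU hF hV,
    fun ψ hψ => ?_, hmem, ?_, Honest.closure_singleton_eq p⟩
  · exact Honest.trace_eq (M := M) ψ ▸ V.nonempty_of_mem (Filter.inter_mem ((hF ψ).1 hψ) hVM)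
  · exact Honest.closure_singleton_eq p ▸ Set.mem_iInter₂.2 fun θ hθ => hhonest θ hθ.1 hθ.2
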